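/- Let $d\geqslant 2$ and let $\Omega\subset\mathbb{R}^d$ be a bounded open set with boundary $\partial\Omega$ of class $\mathcal{C}^1$ (near each boundary point, $\Omega$ is, up to a rigid motion, the set lying strictly on one side of the graph of a $\mathcal{C}^1$ function of $d-1$ variables). Let $n(x)$ be the outward unit normal at $x\in\partial\Omega$, let $\pi$ be the Lebesgue surface measure on $\partial\Omega$ and $\mathrm{d}\sigma$ the Lebesgue surface measure on the unit sphere $\mathbb{S}^{d-1}$. For $x\in\partial\Omega$ set $$\mathbb{S}_+(x)=\{\sigma\in\mathbb{S}^{d-1}:\ \sigma\cdot n(x)>0\},\qquad \tau_-(x,\sigma)=\inf\{s>0:\ x-s\sigma\notin\Omega\},$$ $$\Sigma_+(x)=\{y\in\partial\Omega:\ ]x,y[\,\subset\Omega,\ (x-y)\cdot n(x)>0,\ (x-y)\cdot n(y)<0\},$$ where $]x,y[=\{tx+(1-t)y:\ 0<t<1\}$, and $$\mathcal{J}(x,y)=\mathbf{1}_{\Sigma_+(x)}(y)\,\frac{|(x-y)\cdot n(x)|\,|(x-y)\cdot n(y)|}{|x-y|^{d+1}}$$ (which is $0$ for $y\notin\Sigma_+(x)$,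 in particular for $y=x$). Then, for every $x\in\partial\Omega$: 1. For every nonnegative measurable $g:\mathbb{S}^{d-1}\to\mathbb{R}$, as an identity in $[0,\infty]$, $$\int_{\mathbb{S}_+(x)}g(\sigma)\,|\sigma\cdot n(x)|\,\mathrm{d}\sigma=\int_{\partial\Omega}g\Big(\frac{x-y}{|x-y|}\Big)\,\mathcal{J}(x,y)\,\pi(\mathrm{d}y).$$ 2. For every nonnegative measurable $G:\partial\Omega\to\mathbb{R}$ and every measurable $\varphi:(0,\infty)\to\mathbb{C}$, $$\int_{\mathbb{S}_+(x)}|\sigma\cdot n(x)|\,\varphi(\tau_-(x,\sigma))\,G(x-\tau_-(x,\sigma)\sigma)\,\mathrm{d}\sigma=\int_{\Sigma_+(x)}G(y)\,\varphi(|x-y|)\,\mathcal{J}(x,y)\,\pi(\mathrm{d}y),$$ in the following sense: with $\varphi$ replaced by $|\varphi|$ the identity holds in $[0,\infty]$; consequently one side is absolutely convergent if and only if the other is, and then the identity holds in $\mathbb{C}$. -/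

import Mathlib

open MeasureTheory Set Filter Topology
open scoped RealInnerProductSpace

noncomputable section

namespace BoundaryTransport

/-- Euclidean space `ℝ^d`. -/
abbrev E (d : ℕ) : Type := EuclideanSpace ℝ (Fin d)

variable {d : ℕ}

/-- Near `p`, the set `Ω` is the strict epigraph, in the direction of the unit vector `e`, of a
`C¹` function `Φ` defined on the hyperplane orthogonal to `e`. -/
structure IsLocalEpigraph (Ω : Set (E d)) (p e : E d) (Φ : (ℝ ∙ e)ᗮ → ℝ) : Prop where
  norm_eq : ‖e‖ = 1
  contDiff : ContDiff ℝ 1 Φ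
  mem_iff : ∀ᶠ y in 𝓝 p, (y ∈ Ω ↔ Φ ((ℝ ∙ e)ᗮ.orthogonalProjectionOnto y) < ⟪e, y⟫)

/-- `Ω` has a `C¹` boundary: near each of its boundary points `Ω` lies, up to a rigid motion,
on one side of the graph of a `C¹` function of `d - 1` variables. -/
def HasC1Boundary (Ω : Set (E d)) : Prop :=
  ∀ p ∈ frontier Ω, ∃ (e : E d) (Φ : (ℝ ∙ e)ᗮ → ℝ), IsLocalEpigraph Ω p e Φ

/-- The vector `(∇Φ, -1)`, i.e. `∇Φ - e`, at the point of the graph of `Φ` above or below `p`. -/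
def graphNormal (e : E d) (Φ : (ℝ ∙ e)ᗮ → ℝ) (p : E d) : E d :=
  ((gradient Φ ((ℝ ∙ e)ᗮ.orthogonalProjectionOnto p) : (ℝ ∙ e)ᗮ) : E d) - e

/-- `ν` is the outward unit normal to `Ω` at the boundary point `p`: in a local representation
of `Ω` as the set above the graph of `Φ`, it is `(∇Φ, -1) / |(∇Φ, -1)|`. -/
def IsOutwardUnitNormal (Ω : Set (E d)) (p ν : E d) : Prop :=
  p ∈ frontier Ω ∧ ∃ (e : E d) (Φ : (ℝ ∙ e)ᗮ → ℝ), IsLocalEpigraph Ω p e Φ ∧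
    ν = ‖graphNormal e Φ p‖⁻¹ • graphNormal e Φ p

open Classical in
/-- The outward unit normal `n(p)` (and `0` where there is none). -/
def outwardNormal (Ω : Set (E d)) (p : E d) : E d :=
  if h : ∃ ν, IsOutwardUnitNormal Ω p ν then h.choose else 0

lemma graphNormal_ne_zero {e : E d} (he : ‖e‖ = 1) (Φ : (ℝ ∙ e)ᗮ → ℝ) (p : E d) :
    graphNormal e Φ p ≠ 0 := by
  intro h
  have h1 : ⟪e, graphNormal e Φ p⟫ = -1 := by
    have h2 : ⟪e, ((gradient Φ ((ℝ ∙ e)ᗮ.orthogonalProjectionOnto p) : (ℝ ∙ e)ᗮ) : E d)⟫ = 0 :=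
      Submodule.mem_orthogonal_singleton_iff_inner_right.1 (Subtype.property _)
    rw [graphNormal, inner_sub_right, h2, real_inner_self_eq_norm_sq, he]
    norm_num
  rw [h, inner_zero_right] at h1
  norm_num at h1

lemma IsLocalEpigraph.apply_eq {Ω : Set (E d)} {p e : E d} {Φ : (ℝ ∙ e)ᗮ → ℝ}
    (h : IsLocalEpigraph Ω p e Φ) (hp : p ∈ frontier Ω) :
    Φ ((ℝ ∙ e)ᗮ.orthogonalProjectionOnto p) = ⟪e, p⟫ := by
  have hc : Continuous fun y : E d => Φ ((ℝ ∙ e)ᗮ.orthogonalProjectionOnto y) :=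
    h.contDiff.continuous.comp (ContinuousLinearMap.continuous _)
  have hi : Continuous fun y : E d => ⟪e, y⟫ := by fun_prop
  rw [frontier_eq_closure_inter_closure] at hp
  have h1 := mem_closure_iff_frequently.1 hp.1
  have h2 := mem_closure_iff_frequently.1 hp.2
  refine le_antisymm (not_lt.1 fun hlt => ?_) (not_lt.1 fun hlt => ?_)
  · have := hi.continuousAt.eventually_lt hc.continuousAt hlt
    obtain ⟨y, hy, hy1, hy2⟩ := (h1.and_eventually (this.and h.mem_iff)).exists
    exact lt_asymm hy1 (hy2.1 hy)
  · have := hc.continuousAt.eventually_lt hi.continuousAt hlt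
    obtain ⟨y, hy, hy1, hy2⟩ := (h2.and_eventually (this.and h.mem_iff)).exists
    exact hy (hy2.2 hy1)

lemma IsLocalEpigraph.eventually_ray {Ω : Set (E d)} {p e : E d} {Φ : (ℝ ∙ e)ᗮ → ℝ}
    (h : IsLocalEpigraph Ω p e Φ) (hp : p ∈ frontier Ω) (v : E d) :
    (⟪graphNormal e Φ p, v⟫ < 0 → ∀ᶠ t : ℝ in 𝓝[>] 0, p + t • v ∈ Ω) ∧
    (0 < ⟪graphNormal e Φ p, v⟫ → ∀ᶠ t : ℝ in 𝓝[>] 0, p + t • v ∉ Ω) := by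
  set P := (ℝ ∙ e)ᗮ.orthogonalProjectionOnto with hP
  have hline : HasDerivAt (fun t : ℝ => p + t • v) v 0 := by
    simpa using ((hasDerivAt_id (0 : ℝ)).smul_const v).const_add p
  have hPl : HasDerivAt (fun t : ℝ => P (p + t • v)) (P v) 0 := by
    simpa [Function.comp_def] using P.hasFDerivAt.comp_hasDerivAt (0 : ℝ) hline
  have hΦ : HasFDerivAt Φ (fderiv ℝ Φ (P p)) (P (p + (0 : ℝ) • v)) := by
    simpa using (h.contDiff.differentiable one_ne_zero (P p)).hasFDerivAt
  have hg : fderiv ℝ Φ (P p) (P v) = ⟪((gradient Φ (P p) : (ℝ ∙ e)ᗮ) : E d), v⟫ := by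
    have h3 : fderiv ℝ Φ (P p) (P v) = ⟪gradient Φ (P p), P v⟫ := by
      simp [gradient]
    rw [h3, Submodule.inner_orthogonalProjectionOnto_eq_of_mem_left]
  have hF : HasDerivAt (fun t : ℝ => Φ (P (p + t • v)) - ⟪e, p + t • v⟫)
      ⟪graphNormal e Φ p, v⟫ 0 := by
    have h4 := hΦ.comp_hasDerivAt (0 : ℝ) hPl
    have h5 : HasDerivAt (fun t : ℝ => ⟪e, p + t • v⟫) ⟪e, v⟫ 0 := by
      simpa using (hasDerivAt_const (0 : ℝ) e).inner ℝ hline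
    have h6 := h4.sub h5
    rw [hg] at h6
    rw [graphNormal, inner_sub_left]
    exact h6
  have h0 : Φ (P p) - ⟪e, p⟫ = 0 := sub_eq_zero.2 (h.apply_eq hp)
  have hev : ∀ᶠ t : ℝ in 𝓝[>] 0,
      (p + t • v ∈ Ω ↔ Φ (P (p + t • v)) < ⟪e, p + t • v⟫) := by
    have hc : Tendsto (fun t : ℝ => p + t • v) (𝓝[>] 0) (𝓝 p) := by
      have := hline.continuousAt.tendsto
      simp only [zero_smul, add_zero] at this
      exact this.mono_left nhdsWithin_le_nhds
    exact hc.eventually h.mem_iff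
  have hs := (hasDerivAt_iff_tendsto_slope_zero.1 hF).mono_left
    (nhdsWithin_mono (0 : ℝ) (fun t (ht : 0 < t) => ht.ne'))
  simp only [zero_add, zero_smul, add_zero, h0, sub_zero, smul_eq_mul] at hs
  constructor
  · intro hv
    filter_upwards [hev, hs.eventually_lt_const hv, self_mem_nhdsWithin] with t h1 h2 h3
    rw [h1]
    have : Φ (P (p + t • v)) - ⟪e, p + t • v⟫ < 0 := by
      by_contra hcon
      exact absurd h2 (not_lt.2 (mul_nonneg (inv_nonneg.2 (le_of_lt h3)) (not_lt.1 hcon)))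
    linarith
  · intro hv
    filter_upwards [hev, hs.eventually_const_lt hv, self_mem_nhdsWithin] with t h1 h2 h3
    rw [h1]
    intro hcon
    have h7 := mul_pos (inv_pos.2 h3) (sub_pos.2 hcon)
    nlinarith

/-- There is at most one outward unit normal at a point, whatever the local representation. -/
theorem IsOutwardUnitNormal.unique {Ω : Set (E d)} {p ν ν' : E d}
    (h : IsOutwardUnitNormal Ω p ν) (h' : IsOutwardUnitNormal Ω p ν') : ν = ν' := by
  obtain ⟨hp, e, Φ, hΦ, rfl⟩ := h
  obtain ⟨-, e', Φ', hΦ', rfl⟩ := h'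
  set a := graphNormal e Φ p
  set b := graphNormal e' Φ' p
  have ha : 0 < ‖a‖ := norm_pos_iff.2 (graphNormal_ne_zero hΦ.norm_eq Φ p)
  have hb : 0 < ‖b‖ := norm_pos_iff.2 (graphNormal_ne_zero hΦ'.norm_eq Φ' p)
  by_contra hne
  have hna : ‖‖a‖⁻¹ • a‖ = 1 := norm_smul_inv_norm (norm_pos_iff.1 ha)
  have hnb : ‖‖b‖⁻¹ • b‖ = 1 := norm_smul_inv_norm (norm_pos_iff.1 hb)
  have hlt : ⟪‖a‖⁻¹ • a, ‖b‖⁻¹ • b⟫ < 1 := (inner_lt_one_iff_real_of_norm_eq_one hna hnb).2 hne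
  set v := ‖b‖⁻¹ • b - ‖a‖⁻¹ • a with hv
  have h1 : ⟪‖a‖⁻¹ • a, v⟫ < 0 := by
    rw [hv, inner_sub_right, real_inner_self_eq_norm_sq, hna]; linarith
  have h2 : 0 < ⟪‖b‖⁻¹ • b, v⟫ := by
    rw [hv, inner_sub_right, real_inner_self_eq_norm_sq, hnb, real_inner_comm]; linarith
  rw [real_inner_smul_left] at h1 h2
  have h1' : ⟪a, v⟫ < 0 := by
    by_contra hcon
    exact absurd h1 (not_lt.2 (mul_nonneg (inv_nonneg.2 ha.le) (not_lt.1 hcon)))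
  have h2' : 0 < ⟪b, v⟫ := pos_of_mul_pos_right h2 (inv_nonneg.2 hb.le)
  obtain ⟨t, ht1, ht2⟩ :=
    (((hΦ.eventually_ray hp v).1 h1').and ((hΦ'.eventually_ray hp v).2 h2')).exists
  exact ht2 ht1

lemma IsOutwardUnitNormal.outwardNormal_eq {Ω : Set (E d)} {p ν : E d}
    (h : IsOutwardUnitNormal Ω p ν) : outwardNormal Ω p = ν := by
  have hex : ∃ ν, IsOutwardUnitNormal Ω p ν := ⟨ν, h⟩
  rw [outwardNormal, dif_pos hex]
  exact hex.choose_spec.unique h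

lemma HasC1Boundary.isOutwardUnitNormal {Ω : Set (E d)} (hΩ : HasC1Boundary Ω) {p : E d}
    (hp : p ∈ frontier Ω) : IsOutwardUnitNormal Ω p (outwardNormal Ω p) := by
  obtain ⟨e, Φ, h⟩ := hΩ p hp
  have hn : IsOutwardUnitNormal Ω p (‖graphNormal e Φ p‖⁻¹ • graphNormal e Φ p) :=
    ⟨hp, e, Φ, h, rfl⟩
  rwa [hn.outwardNormal_eq]

/-- The Lebesgue surface measure `π` on `∂Ω`, as a measure on `ℝ^d` carried by `∂Ω`: the
`(d - 1)`-dimensional Hausdorff measure, normalized to agree with Lebesgue measure on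
hyperplanes. -/
def surfaceMeasure (Ω : Set (E d)) : Measure (E d) :=
  (Measure.euclideanHausdorffMeasure (d - 1)).restrict (frontier Ω)

/-- The Lebesgue surface measure `dσ` on the unit sphere. -/
def sphereMeasure (d : ℕ) : Measure (Metric.sphere (0 : E d) 1) :=
  (volume : Measure (E d)).toSphere

/-- The half sphere `𝕊₊(x)` of the directions `σ` with `σ · n(x) > 0`. -/
def halfSphere (Ω : Set (E d)) (x : E d) : Set (Metric.sphere (0 : E d) 1) :=
  {σ | 0 < ⟪(σ : E d), outwardNormal Ω x⟫}

/-- The backward travel time `τ₋(x, v) = inf {s > 0 : x - s v ∉ Ω}`. -/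
def travelTime (Ω : Set (E d)) (x v : E d) : ℝ :=
  sInf {s : ℝ | 0 < s ∧ x - s • v ∉ Ω}

/-- The part `Σ₊(x)` of `∂Ω` that is visible from `x` through `Ω`, transversally. -/
def visibleBoundary (Ω : Set (E d)) (x : E d) : Set (E d) :=
  {y | y ∈ frontier Ω ∧ openSegment ℝ x y ⊆ Ω ∧
    0 < ⟪x - y, outwardNormal Ω x⟫ ∧ ⟪x - y, outwardNormal Ω y⟫ < 0}

/-- The kernel
`𝒥(x, y) = 1_{Σ₊(x)}(y) |(x - y) · n(x)| |(x - y) · n(y)| / |x - y|^(d + 1)`. -/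
def kernelJ (Ω : Set (E d)) (x y : E d) : ℝ :=
  (visibleBoundary Ω x).indicator
    (fun y => |⟪x - y, outwardNormal Ω x⟫| * |⟪x - y, outwardNormal Ω y⟫| / ‖x - y‖ ^ (d + 1)) y

end BoundaryTransport

end

/-! Both identities are one change of variables along the direction map y ↦ (x - y)/|x - y| on
Σ₊(x). This map is injective, since y is recovered as x - τ₋σ. Its image is 𝕊₊(x) up to the grazing
directions, whose ray first meets ∂Ω tangentially. The pulled-back sphere measure has density |(x -
y)·n(y)| / |x - y|^d with respect to π (`comap_visibleDirection_sphereMeasure`), and the remaining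
factor |σ·n(x)| turns this density into 𝒥.

The density is found by local comparison. Sphere measure is d times the volume of the unit cone over
a set. Near a transversal point p, the central projection from x onto the tangent hyperplane at p is
bi-Lipschitz on ∂Ω with constant c as close to 1 as desired, the round cone lies between two flat
cones of nearly equal height, and a flat cone has an explicit volume. Thus the two measures agree
locally up to a factor c^(2d) (`exists_nhds_solidCone_bounds`). Letting c → 1 gives equality
(`measure_le_of_locally_le_pow`).

Grazing directions are negligible by the equidimensional case of Sard's theorem: adding a radial
parameter to the boundary graph gives a C¹ map between spaces of dimension d whose differential is
singular at tangency points (`volume_solidCone_grazing`). -/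

noncomputable section

namespace BoundaryTransport

/-! ### Comparison of measures from local bounds -/

section MeasureComparison

variable {X : Type*} [TopologicalSpace X] [SecondCountableTopology X] [MeasurableSpace X]
  [OpensMeasurableSpace X]

/-- By second countability, countably many of the neighbourhoods cover the space. Made disjoint,
they split any measurable set into pieces to which the bound applies, and the pieces are summed. -/
lemma measure_le_of_locally_le {μ ν : Measure X} {c : ENNReal}
    (h : ∀ x, ∃ U ∈ 𝓝 x, ∀ A ⊆ U, MeasurableSet A → μ A ≤ c * ν A) : μ ≤ c • ν := by
  choose U hU hle using h
  obtain ⟨s, hs, hcov⟩ := TopologicalSpace.countable_cover_nhds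
    (f := fun x => interior (U x)) fun x => interior_mem_nhds.2 (hU x)
  have hne : s.Nonempty ∨ IsEmpty X := by
    rcases s.eq_empty_or_nonempty with rfl | h
    · right
      simp only [mem_empty_iff_false, iUnion_of_empty, iUnion_empty] at hcov
      exact univ_eq_empty_iff.1 hcov.symm
    · exact Or.inl h
  rcases hne with hne | hemp
  swap
  · intro A
    rw [eq_empty_of_isEmpty A]
    simp
  obtain ⟨f, rfl⟩ := hs.exists_eq_range hne
  rw [biUnion_range] at hcov
  refine Measure.le_intro fun A hA _ => ?_
  set D : ℕ → Set X := disjointed fun i => interior (U (f i)) with hD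
  have hDm : ∀ i, MeasurableSet (D i) :=
    MeasurableSet.disjointed fun i => isOpen_interior.measurableSet
  have hAeq : A = ⋃ i, A ∩ D i := by
    rw [← inter_iUnion, hD, iUnion_disjointed, hcov, inter_univ]
  have hdis : Pairwise (Function.onFun Disjoint fun i => A ∩ D i) := fun i j hij =>
    ((disjoint_disjointed _ hij).mono inter_subset_right inter_subset_right)
  calc μ A = ∑' i, μ (A ∩ D i) := by
        conv_lhs => rw [hAeq]
        exact measure_iUnion hdis fun i => hA.inter (hDm i)
    _ ≤ ∑' i, c * ν (A ∩ D i) := by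
        refine ENNReal.tsum_le_tsum fun i => hle (f i) _ ?_ (hA.inter (hDm i))
        exact inter_subset_right.trans ((disjointed_subset _ i).trans interior_subset)
    _ = c * ν A := by
        rw [ENNReal.tsum_mul_left]
        conv_rhs => rw [hAeq, measure_iUnion hdis fun i => hA.inter (hDm i)]
    _ = (c • ν) A := by simp

/-- The neighbourhoods may shrink as c → 1: for each c the bound is first made global, and only then
does c tend to 1. -/
lemma measure_le_of_locally_le_pow {μ ν : Measure X} (m : ℕ)
    (h : ∀ c : ℝ, 1 < c → ∀ x, ∃ U ∈ 𝓝 x, ∀ A ⊆ U, MeasurableSet A →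
      μ A ≤ ENNReal.ofReal (c ^ m) * ν A) : μ ≤ ν := by
  intro A
  by_cases hA : ν A = ⊤
  · rw [hA]; exact le_top
  have hlim : Tendsto (fun c : ℝ => ENNReal.ofReal (c ^ m) * ν A) (𝓝[>] 1) (𝓝 (ν A)) := by
    have h1 : Tendsto (fun c : ℝ => ENNReal.ofReal (c ^ m)) (𝓝[>] 1) (𝓝 1) := by
      have : Continuous fun c : ℝ => ENNReal.ofReal (c ^ m) :=
        ENNReal.continuous_ofReal.comp (continuous_pow m)
      have h2 := this.tendsto 1
      simp only [one_pow, ENNReal.ofReal_one] at h2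
      exact h2.mono_left nhdsWithin_le_nhds
    simpa using ENNReal.Tendsto.mul_const h1 (Or.inr hA)
  refine ge_of_tendsto hlim ?_
  filter_upwards [self_mem_nhdsWithin] with c hc
  exact measure_le_of_locally_le (h c hc) A

end MeasureComparison

lemma euclideanHausdorffMeasure_image_le {X Y : Type*} [MetricSpace X] [MeasurableSpace X]
    [BorelSpace X] [MetricSpace Y] [MeasurableSpace Y] [BorelSpace Y] {c : ℝ} (hc : 0 ≤ c)
    {f : X → Y} {s : Set X} (n : ℕ) (hf : ∀ a ∈ s, ∀ b ∈ s, dist (f a) (f b) ≤ c * dist a b) :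
    Measure.euclideanHausdorffMeasure n (f '' s) ≤
      ENNReal.ofReal (c ^ n) * Measure.euclideanHausdorffMeasure n s := by
  have hL : LipschitzOnWith c.toNNReal f s := by
    refine LipschitzOnWith.of_dist_le_mul fun a ha b hb => ?_
    rw [Real.coe_toNNReal _ hc]
    exact hf a ha b hb
  have h := hL.hausdorffMeasure_image_le (d := (n : ℝ)) (Nat.cast_nonneg n)
  simp only [Measure.euclideanHausdorffMeasure_def, Measure.smul_apply, ENNReal.smul_def,
    smul_eq_mul]
  rw [mul_left_comm]
  gcongr
  refine h.trans_eq ?_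
  rw [ENNReal.rpow_natCast, ENNReal.ofReal_pow hc, ENNReal.ofReal]

/-! ### Normals and chords of a C¹ boundary -/

variable {d : ℕ}

lemma IsLocalEpigraph.eventually {Ω : Set (E d)} {p e : E d} {Φ : (ℝ ∙ e)ᗮ → ℝ}
    (h : IsLocalEpigraph Ω p e Φ) : ∀ᶠ q in 𝓝 p, IsLocalEpigraph Ω q e Φ := by
  filter_upwards [eventually_eventually_nhds.2 h.mem_iff] with q hq
  exact ⟨h.norm_eq, h.contDiff, hq⟩

lemma continuous_graphNormal {e : E d} {Φ : (ℝ ∙ e)ᗮ → ℝ} (hΦ : ContDiff ℝ 1 Φ) :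
    Continuous (graphNormal e Φ) := by
  have h1 : Continuous (gradient Φ) :=
    (InnerProductSpace.toDual ℝ _).symm.continuous.comp (hΦ.continuous_fderiv one_ne_zero)
  unfold graphNormal
  fun_prop

lemma IsLocalEpigraph.outwardNormal_eq {Ω : Set (E d)} {p e : E d} {Φ : (ℝ ∙ e)ᗮ → ℝ}
    (h : IsLocalEpigraph Ω p e Φ) (hp : p ∈ frontier Ω) :
    outwardNormal Ω p = ‖graphNormal e Φ p‖⁻¹ • graphNormal e Φ p :=
  IsOutwardUnitNormal.outwardNormal_eq ⟨hp, e, Φ, h, rfl⟩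

lemma IsLocalEpigraph.graphNormal_eq {Ω : Set (E d)} {p e : E d} {Φ : (ℝ ∙ e)ᗮ → ℝ}
    (h : IsLocalEpigraph Ω p e Φ) (hp : p ∈ frontier Ω) :
    graphNormal e Φ p = ‖graphNormal e Φ p‖ • outwardNormal Ω p := by
  rw [h.outwardNormal_eq hp,
    smul_inv_smul₀ (norm_ne_zero_iff.2 (graphNormal_ne_zero h.norm_eq Φ p))]

lemma continuousOn_outwardNormal {Ω : Set (E d)} (hΩ : HasC1Boundary Ω) :
    ContinuousOn (outwardNormal Ω) (frontier Ω) := by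
  intro p hp
  obtain ⟨e, Φ, h⟩ := hΩ p hp
  have hc := continuous_graphNormal h.contDiff
  have hcont : ContinuousAt (fun q => ‖graphNormal e Φ q‖⁻¹ • graphNormal e Φ q) p :=
    (hc.norm.continuousAt.inv₀ (norm_ne_zero_iff.2 (graphNormal_ne_zero h.norm_eq Φ p))).smul
      hc.continuousAt
  refine hcont.continuousWithinAt.congr_of_eventuallyEq ?_ (h.outwardNormal_eq hp)
  filter_upwards [mem_nhdsWithin_of_mem_nhds h.eventually, self_mem_nhdsWithin] with q hq hqf
  exact hq.outwardNormal_eq hqf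

lemma norm_outwardNormal {Ω : Set (E d)} (hΩ : HasC1Boundary Ω) {p : E d} (hp : p ∈ frontier Ω) :
    ‖outwardNormal Ω p‖ = 1 := by
  obtain ⟨e, Φ, h⟩ := hΩ p hp
  rw [h.outwardNormal_eq hp]
  exact norm_smul_inv_norm (graphNormal_ne_zero h.norm_eq Φ p)

/-- The rays issued from a boundary point enter or leave `Ω` according to the sign of their
scalar product with the outward normal. -/
lemma eventually_ray {Ω : Set (E d)} (hΩ : HasC1Boundary Ω) {p : E d} (hp : p ∈ frontier Ω)
    (v : E d) :
    (⟪outwardNormal Ω p, v⟫ < 0 → ∀ᶠ t : ℝ in 𝓝[>] 0, p + t • v ∈ Ω) ∧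
    (0 < ⟪outwardNormal Ω p, v⟫ → ∀ᶠ t : ℝ in 𝓝[>] 0, p + t • v ∉ Ω) := by
  obtain ⟨e, Φ, h⟩ := hΩ p hp
  have hpos : 0 < ‖graphNormal e Φ p‖ := norm_pos_iff.2 (graphNormal_ne_zero h.norm_eq Φ p)
  have hr := h.eventually_ray hp v
  rw [h.graphNormal_eq hp, real_inner_smul_left] at hr
  exact ⟨fun hv => hr.1 (mul_neg_of_pos_of_neg hpos hv), fun hv => hr.2 (mul_pos hpos hv)⟩

/-- This function vanishes on ∂Ω near p. Strict differentiability is what controls chords both of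
whose endpoints vary. -/
lemma hasStrictFDerivAt_graph {e : E d} {Φ : (ℝ ∙ e)ᗮ → ℝ} (hΦ : ContDiff ℝ 1 Φ) (p : E d) :
    HasStrictFDerivAt (fun y : E d => Φ ((ℝ ∙ e)ᗮ.orthogonalProjectionOnto y) - ⟪e, y⟫)
      (innerSL ℝ (graphNormal e Φ p)) p := by
  set P := (ℝ ∙ e)ᗮ.orthogonalProjectionOnto
  have h1 : HasStrictFDerivAt Φ (fderiv ℝ Φ (P p)) (P p) :=
    hΦ.contDiffAt.hasStrictFDerivAt one_ne_zero
  have h2 := (h1.comp p P.hasStrictFDerivAt).sub (innerSL ℝ e).hasStrictFDerivAt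
  refine h2.congr_fderiv ?_
  ext v
  have h3 : fderiv ℝ Φ (P p) (P v) = ⟪gradient Φ (P p), P v⟫ := by
    simp [gradient]
  have h4 : ⟪gradient Φ (P p), P v⟫ = ⟪((gradient Φ (P p) : (ℝ ∙ e)ᗮ) : E d), v⟫ :=
    Submodule.inner_orthogonalProjectionOnto_eq_of_mem_left _ _
  simp only [_root_.sub_apply, ContinuousLinearMap.comp_apply, innerSL_apply_apply,
    graphNormal, inner_sub_left]
  rw [h3, h4]

/-- Chords of `∂Ω` near `p` are almost orthogonal to the normal at `p`. -/
lemma eventually_inner_outwardNormal_le {Ω : Set (E d)} (hΩ : HasC1Boundary Ω) {p : E d}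
    (hp : p ∈ frontier Ω) {ε : ℝ} (hε : 0 < ε) :
    ∀ᶠ z : E d × E d in 𝓝 (p, p), z.1 ∈ frontier Ω → z.2 ∈ frontier Ω →
      |⟪outwardNormal Ω p, z.1 - z.2⟫| ≤ ε * ‖z.1 - z.2‖ := by
  obtain ⟨e, Φ, h⟩ := hΩ p hp
  obtain ⟨c, hpos, hc⟩ : ∃ c : ℝ, 0 < c ∧ graphNormal e Φ p = c • outwardNormal Ω p :=
    ⟨_, norm_pos_iff.2 (graphNormal_ne_zero h.norm_eq Φ p), h.graphNormal_eq hp⟩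
  have hs := (hasStrictFDerivAt_graph h.contDiff p).isLittleO.def (mul_pos hpos hε)
  have hz : ∀ᶠ q in 𝓝 p, q ∈ frontier Ω →
      Φ ((ℝ ∙ e)ᗮ.orthogonalProjectionOnto q) - ⟪e, q⟫ = 0 := by
    filter_upwards [h.eventually] with q hq hqf
    exact sub_eq_zero.2 (hq.apply_eq hqf)
  rw [nhds_prod_eq] at hs ⊢
  filter_upwards [hs, hz.prod_inl (𝓝 p), hz.prod_inr (𝓝 p)] with z h1 h2 h3 h4 h5
  rw [h2 h4, h3 h5, sub_zero, zero_sub, norm_neg, innerSL_apply_apply, hc,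
    real_inner_smul_left, Real.norm_eq_abs, abs_mul, abs_of_pos hpos, mul_assoc] at h1
  exact le_of_mul_le_mul_left h1 hpos

/-! ### Flat cones and central projection -/

open scoped Pointwise in
/-- The volume of the cone over a set `B` in the hyperplane `⟪ν, w⟫ = h`, truncated at the
height `a`. -/
lemma volume_truncatedCone (hd : d ≠ 0) {ν : E d} (hν : ‖ν‖ = 1) {h a : ℝ} (hh : 0 < h)
    (ha : 0 ≤ a) {B : Set (E d)} (hB : MeasurableSet B) (hBh : ∀ w ∈ B, ⟪ν, w⟫ = h) :
    volume {w : E d | 0 < ⟪ν, w⟫ ∧ ⟪ν, w⟫ < a ∧ (h / ⟪ν, w⟫) • w ∈ B} =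
      ENNReal.ofReal (a ^ d / (d * h ^ (d - 1))) *
        Measure.euclideanHausdorffMeasure (d - 1) B := by
  have hν0 : ν ≠ 0 := fun h0 => by simp [h0] at hν
  set D : Set (E d) := {w : E d | 0 < ⟪ν, w⟫ ∧ ⟪ν, w⟫ < a ∧ (h / ⟪ν, w⟫) • w ∈ B} with hD
  have hi : Measurable fun w : E d => ⟪ν, w⟫ := by fun_prop
  have hDm : MeasurableSet D := by
    refine (measurableSet_lt measurable_const hi).inter
      ((measurableSet_lt hi measurable_const).inter ?_)
    exact ((measurable_const.div hi).smul measurable_id) hB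
  have hvol : (volume : Measure (E d)) = Measure.euclideanHausdorffMeasure d :=
    (EuclideanSpace.euclideanHausdorffMeasure_eq_volume d).symm
  have hfr : Module.finrank ℝ (E d) = d := by simp
  have hfub := EuclideanGeometry.euclideanHausdorffMeasure_eq_lintegral (P := E d) (0 : E d) hν0 hDm
  rw [hfr] at hfub
  have hmk : ∀ s : ℝ, ∀ w : E d,
      w ∈ AffineSubspace.mk' (s • ν +ᵥ (0 : E d)) (ℝ ∙ ν)ᗮ ↔ ⟪ν, w⟫ = s := by
    intro s w
    rw [AffineSubspace.mem_mk', Submodule.mem_orthogonal_singleton_iff_inner_right]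
    simp only [vadd_eq_add, add_zero, vsub_eq_sub, inner_sub_right, real_inner_smul_right,
      real_inner_self_eq_norm_sq, hν, one_pow, mul_one, sub_eq_zero]
  have hslice : ∀ s : ℝ, Measure.euclideanHausdorffMeasure (d - 1)
      (D ∩ AffineSubspace.mk' (s • ν +ᵥ (0 : E d)) (ℝ ∙ ν)ᗮ) =
      (Ioo 0 a).indicator (fun s => ENNReal.ofReal (s ^ (d - 1) / h ^ (d - 1)) *
        Measure.euclideanHausdorffMeasure (d - 1) B) s := by
    intro s
    by_cases hs : s ∈ Ioo 0 a
    · have hs0 : s / h ≠ 0 := (div_pos hs.1 hh).ne'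
      -- The slice at height s is a homothetic copy of B, so Fubini along ν reduces the volume to
      -- the integral of (s/h)^(d-1) over (0, a).
      have hset : D ∩ (AffineSubspace.mk' (s • ν +ᵥ (0 : E d)) (ℝ ∙ ν)ᗮ : Set (E d)) =
          (s / h) • B := by
        ext w
        rw [mem_inter_iff, SetLike.mem_coe, hmk, mem_smul_set_iff_inv_smul_mem₀ hs0, inv_div, hD]
        constructor
        · rintro ⟨⟨-, -, h3⟩, h4⟩
          rwa [h4] at h3
        · intro h3
          have h4 := hBh _ h3
          rw [real_inner_smul_right] at h4
          have h5 : ⟪ν, w⟫ = s := by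
            have := hs.1.ne'
            field_simp at h4
            linarith
          refine ⟨⟨?_, ?_, ?_⟩, h5⟩
          · rw [h5]; exact hs.1
          · rw [h5]; exact hs.2
          · rwa [h5]
      rw [indicator_of_mem hs, hset, Measure.euclideanHausdorffMeasure_smul₀ _ hs0]
      rw [← div_pow, ENNReal.ofReal_pow (div_pos hs.1 hh).le, ← Real.enorm_eq_ofReal
        (div_pos hs.1 hh).le]
      rw [ENNReal.smul_def, smul_eq_mul]
      simp [enorm_eq_nnnorm]
    · rw [indicator_of_notMem hs]
      have : D ∩ (AffineSubspace.mk' (s • ν +ᵥ (0 : E d)) (ℝ ∙ ν)ᗮ : Set (E d)) = ∅ := by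
        ext w
        simp only [mem_inter_iff, SetLike.mem_coe, hmk, mem_empty_iff_false, iff_false, not_and]
        rintro ⟨h1, h2, -⟩ h3
        exact hs ⟨h3 ▸ h1, h3 ▸ h2⟩
      rw [this, measure_empty]
  rw [hvol, hfub]
  simp_rw [hslice]
  have hn : ‖ν‖ₑ = 1 := by rw [← ofReal_norm, hν, ENNReal.ofReal_one]
  rw [hn, one_mul, lintegral_indicator measurableSet_Ioo, lintegral_mul_const _ (by fun_prop)]
  congr 1
  have hint : IntegrableOn (fun s : ℝ => s ^ (d - 1) / h ^ (d - 1)) (Ioc 0 a) :=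
    ((continuous_pow (d - 1)).div_const _).integrableOn_Ioc
  rw [restrict_Ioo_eq_restrict_Ioc, ← ofReal_integral_eq_lintegral_ofReal hint]
  · rw [integral_div, ← intervalIntegral.integral_of_le ha, integral_pow]
    have h1 : d - 1 + 1 = d := Nat.succ_pred_eq_of_ne_zero hd
    have h2 : ((d - 1 : ℕ) : ℝ) + 1 = d := by exact_mod_cast congrArg (Nat.cast (R := ℝ)) h1
    rw [h1, h2, zero_pow hd, sub_zero, div_div]
  · filter_upwards [ae_restrict_mem measurableSet_Ioc] with s hs
    exact div_nonneg (pow_nonneg hs.1.le _) (pow_nonneg hh.le _)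

lemma euclideanHausdorffMeasure_le_image {X Y : Type*} [MetricSpace X] [MeasurableSpace X]
    [BorelSpace X] [MetricSpace Y] [MeasurableSpace Y] [BorelSpace Y] {c : ℝ} (hc : 0 ≤ c)
    {f : X → Y} {s : Set X} (n : ℕ) (hf : ∀ a ∈ s, ∀ b ∈ s, dist a b ≤ c * dist (f a) (f b)) :
    Measure.euclideanHausdorffMeasure n s ≤
      ENNReal.ofReal (c ^ n) * Measure.euclideanHausdorffMeasure n (f '' s) := by
  rcases isEmpty_or_nonempty X with hX | hX
  · rw [eq_empty_of_isEmpty s]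
    simp
  have hinj : InjOn f s := by
    intro a ha b hb hab
    have := hf a ha b hb
    rw [hab, dist_self, mul_zero] at this
    exact dist_le_zero.1 this
  have hinv : ∀ a ∈ s, Function.invFunOn f s (f a) = a := fun a ha => hinj.leftInvOn_invFunOn ha
  have himg : Function.invFunOn f s '' (f '' s) = s := by
    rw [← image_comp]
    exact (image_congr fun a ha => hinv a ha).trans (image_id s)
  conv_lhs => rw [← himg]
  refine euclideanHausdorffMeasure_image_le hc n ?_
  rintro _ ⟨a, ha, rfl⟩ _ ⟨b, hb, rfl⟩
  rw [hinv a ha, hinv b hb]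
  exact hf a ha b hb

/-- The projection from `0` of the point `x - y` onto the hyperplane `⟪ν, w⟫ = h`. -/
def rayProjection (x ν : E d) (h : ℝ) (y : E d) : E d := (h / ⟪ν, x - y⟫) • (x - y)

lemma inner_rayProjection {x ν y : E d} (h : ℝ) (hy : ⟪ν, x - y⟫ ≠ 0) :
    ⟪ν, rayProjection x ν h y⟫ = h := by
  rw [rayProjection, real_inner_smul_right, div_mul_cancel₀ _ hy]

/-- The target hyperplane is taken at the height of x - y itself, so the scaling factor is 1 there.
On vectors orthogonal to ν the derivative is then minus the identity. -/
lemma hasStrictFDerivAt_rayProjection {x ν y : E d} (hy : ⟪ν, x - y⟫ ≠ 0) :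
    HasStrictFDerivAt (rayProjection x ν ⟪ν, x - y⟫)
      (((⟪ν, x - y⟫)⁻¹ • (innerSL ℝ ν).smulRight (x - y)) - ContinuousLinearMap.id ℝ (E d)) y := by
  have h1 : HasStrictFDerivAt (fun z : E d => x - z) (-ContinuousLinearMap.id ℝ (E d)) y :=
    (hasStrictFDerivAt_id y).const_sub x
  have h2 : HasStrictFDerivAt (fun z : E d => ⟪ν, x - z⟫)
      ((innerSL ℝ ν).comp (-ContinuousLinearMap.id ℝ (E d))) y :=
    (innerSL ℝ ν).hasStrictFDerivAt.comp y h1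
  have h3 := ((hasStrictDerivAt_inv hy).comp_hasStrictFDerivAt y h2).const_mul ⟪ν, x - y⟫
  refine (h3.smul h1).congr_fderiv ?_
  ext1 v
  simp only [Function.comp_apply, smul_neg, _root_.add_apply, _root_.smul_apply, _root_.sub_apply,
    _root_.neg_apply, ContinuousLinearMap.smulRight_apply, ContinuousLinearMap.comp_apply,
    ContinuousLinearMap.id_apply, innerSL_apply_apply, inner_neg_right, smul_eq_mul]
  rw [mul_inv_cancel₀ hy, one_smul, smul_smul, neg_add_eq_sub]
  congr 2
  field_simp

/-- The central projection from `x` onto the tangent hyperplane at `p` is almost an isometry on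
`∂Ω` near `p`. -/
lemma eventually_rayProjection_bilipschitz {Ω : Set (E d)} (hΩ : HasC1Boundary Ω) {x p : E d}
    (hp : p ∈ frontier Ω) (hpx : 0 < ⟪-outwardNormal Ω p, x - p⟫) {c : ℝ} (hc : 1 < c) :
    ∀ᶠ z : E d × E d in 𝓝 (p, p), z.1 ∈ frontier Ω → z.2 ∈ frontier Ω →
      ‖rayProjection x (-outwardNormal Ω p) ⟪-outwardNormal Ω p, x - p⟫ z.1 -
        rayProjection x (-outwardNormal Ω p) ⟪-outwardNormal Ω p, x - p⟫ z.2‖ ≤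
          c * ‖z.1 - z.2‖ ∧
      ‖z.1 - z.2‖ ≤ c * ‖rayProjection x (-outwardNormal Ω p) ⟪-outwardNormal Ω p, x - p⟫ z.1 -
        rayProjection x (-outwardNormal Ω p) ⟪-outwardNormal Ω p, x - p⟫ z.2‖ := by
  set ν := -outwardNormal Ω p with hν
  set h := ⟪ν, x - p⟫ with hh
  -- The two summands of M account for two errors: the remainder in strict differentiability, and
  -- the rank-one part of the derivative, which is small on chords of ∂Ω.
  set M := 1 + h⁻¹ * ‖x - p‖ with hM
  have hMpos : 0 < M := by positivity
  have hc0 : 0 < c := by linarith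
  have hδ : 0 < (c - 1) / c := div_pos (by linarith) hc0
  have hε : 0 < (c - 1) / c / M := div_pos hδ hMpos
  filter_upwards [(hasStrictFDerivAt_rayProjection hpx.ne').isLittleO.def hε,
    eventually_inner_outwardNormal_le hΩ hp hε] with z h1 h2 h3 h4
  have h5 := h2 h3 h4
  set w := z.1 - z.2 with hw
  set q := rayProjection x ν h z.1 - rayProjection x ν h z.2 with hq
  simp only [_root_.sub_apply, _root_.smul_apply, ContinuousLinearMap.smulRight_apply,
    innerSL_apply_apply, ContinuousLinearMap.id_apply] at h1
  -- The sum appears because the tangential derivative is -id. The factor 1 - 1/c gives ‖w‖ ≤ c‖q‖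
  -- and, being at most c - 1, also ‖q‖ ≤ c‖w‖.
  have h6 : ‖q + w‖ ≤ (c - 1) / c * ‖w‖ := by
    have h7 : q + w = (q - (h⁻¹ • ⟪ν, w⟫ • (x - p) - w)) + h⁻¹ • ⟪ν, w⟫ • (x - p) := by abel
    have h8 : ‖h⁻¹ • ⟪ν, w⟫ • (x - p)‖ ≤ h⁻¹ * ((c - 1) / c / M * ‖w‖ * ‖x - p‖) := by
      rw [norm_smul, norm_smul, Real.norm_eq_abs, Real.norm_eq_abs, abs_of_pos (inv_pos.2 hpx)]
      gcongr
      rw [hν, inner_neg_left, abs_neg]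
      exact h5
    calc ‖q + w‖ ≤ ‖q - (h⁻¹ • ⟪ν, w⟫ • (x - p) - w)‖ + ‖h⁻¹ • ⟪ν, w⟫ • (x - p)‖ := by
          rw [h7]; exact norm_add_le _ _
      _ ≤ (c - 1) / c / M * ‖w‖ + h⁻¹ * ((c - 1) / c / M * ‖w‖ * ‖x - p‖) := add_le_add h1 h8
      _ = (c - 1) / c / M * M * ‖w‖ := by rw [hM]; ring
      _ = (c - 1) / c * ‖w‖ := by rw [div_mul_cancel₀ _ hMpos.ne']
  have h9 : ‖q‖ ≤ ‖q + w‖ + ‖w‖ := by simpa using norm_sub_le (q + w) w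
  have h10 : ‖w‖ ≤ ‖q + w‖ + ‖q‖ := by simpa using norm_sub_le (q + w) q
  have hcc : (c - 1) / c ≤ c - 1 := div_le_self (by linarith) hc.le
  constructor
  · have := mul_le_mul_of_nonneg_right hcc (norm_nonneg w)
    linarith
  · have h11 : c * ((c - 1) / c * ‖w‖) = (c - 1) * ‖w‖ := by field_simp
    have h12 := mul_le_mul_of_nonneg_left (h10.trans (add_le_add_left h6 ‖q‖)) hc0.le
    linarith

/-! ### Solid angle and its density -/

/-- The density, with respect to the surface measure, of the solid angle under which the boundary
is seen from `x`. -/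
def solidAngleDensity (Ω : Set (E d)) (x y : E d) : ℝ :=
  |⟪x - y, outwardNormal Ω y⟫| / ‖x - y‖ ^ d

lemma solidAngleDensity_nonneg (Ω : Set (E d)) (x y : E d) : 0 ≤ solidAngleDensity Ω x y := by
  unfold solidAngleDensity; positivity

lemma continuousOn_solidAngleDensity {Ω : Set (E d)} (hΩ : HasC1Boundary Ω) (x : E d) :
    ContinuousOn (solidAngleDensity Ω x) (frontier Ω \ {x}) := by
  have h1 : ContinuousOn (outwardNormal Ω) (frontier Ω \ {x}) :=
    (continuousOn_outwardNormal hΩ).mono sdiff_subset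
  have h2 : ContinuousOn (fun y : E d => x - y) (frontier Ω \ {x}) := by fun_prop
  refine (h2.inner h1).abs.div (h2.norm.pow d) fun y hy => ?_
  exact pow_ne_zero _ (norm_ne_zero_iff.2 (sub_ne_zero.2 (Ne.symm hy.2)))

/-- The cone with vertex `0` and radius `1` spanned by the directions from the points of `A`
to `x`. -/
def solidCone (x : E d) (A : Set (E d)) : Set (E d) :=
  {w | ∃ t ∈ Ioo (0 : ℝ) 1, ∃ y ∈ A, w = t • ‖x - y‖⁻¹ • (x - y)}

/-- The ray in the direction x - y leaves the unit ball at height ⟪ν, x - y⟫ / ‖x - y‖. An upper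
bound for this ratio encloses the round cone in a flat one; a lower bound gives the reverse
inclusion below. -/
lemma solidCone_subset_truncatedCone {x ν : E d} {h a : ℝ} {A : Set (E d)}
    (hA : ∀ y ∈ A, 0 < ⟪ν, x - y⟫ ∧ ⟪ν, x - y⟫ ≤ a * ‖x - y‖) :
    solidCone x A ⊆
      {w | 0 < ⟪ν, w⟫ ∧ ⟪ν, w⟫ < a ∧ (h / ⟪ν, w⟫) • w ∈ rayProjection x ν h '' A} := by
  rintro _ ⟨t, ht, y, hy, rfl⟩
  obtain ⟨h1, h2⟩ := hA y hy
  have hne : x - y ≠ 0 := by rintro h0; simp [h0] at h1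
  have hpos : 0 < ‖x - y‖ := norm_pos_iff.2 hne
  have hw : ⟪ν, t • ‖x - y‖⁻¹ • (x - y)⟫ = t * (⟪ν, x - y⟫ / ‖x - y‖) := by
    rw [real_inner_smul_right, real_inner_smul_right]; ring
  have h3 : 0 < ⟪ν, x - y⟫ / ‖x - y‖ := div_pos h1 hpos
  refine ⟨?_, ?_, y, hy, ?_⟩
  · rw [hw]; exact mul_pos ht.1 h3
  · rw [hw]
    calc t * (⟪ν, x - y⟫ / ‖x - y‖) < 1 * (⟪ν, x - y⟫ / ‖x - y‖) := by gcongr; exact ht.2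
      _ ≤ a := by rw [one_mul, div_le_iff₀ hpos]; exact h2
  · rw [hw, rayProjection, smul_smul, smul_smul]
    congr 1
    have := ht.1.ne'
    field_simp

lemma truncatedCone_subset_solidCone {x ν : E d} {h a : ℝ} {A : Set (E d)} (hh : 0 < h)
    (hA : ∀ y ∈ A, 0 < ⟪ν, x - y⟫ ∧ a * ‖x - y‖ ≤ ⟪ν, x - y⟫) :
    {w | 0 < ⟪ν, w⟫ ∧ ⟪ν, w⟫ < a ∧ (h / ⟪ν, w⟫) • w ∈ rayProjection x ν h '' A} ⊆
      solidCone x A := by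
  rintro w ⟨h1, h2, y, hy, h3⟩
  obtain ⟨h4, h5⟩ := hA y hy
  have hne : x - y ≠ 0 := by rintro h0; simp [h0] at h4
  have hpos : 0 < ‖x - y‖ := norm_pos_iff.2 hne
  refine ⟨⟪ν, w⟫ / (⟪ν, x - y⟫ / ‖x - y‖), ⟨by positivity, ?_⟩, y, hy, ?_⟩
  · rw [div_lt_one (by positivity)]
    exact h2.trans_le ((le_div_iff₀ hpos).2 h5)
  · have h6 : w = (⟪ν, w⟫ / h) • (h / ⟪ν, w⟫) • w := by
      rw [smul_smul, div_mul_div_cancel₀ hh.ne', div_self h1.ne', one_smul]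
    rw [← h3, rayProjection, smul_smul] at h6
    conv_lhs => rw [h6]
    rw [smul_smul]
    congr 1
    field_simp

/-- Near a point `p` of `∂Ω` where the segment from `x` is transversal to `∂Ω`, the solid angle is
comparable, up to constants close to `1`, with its density integrated on the boundary. -/
lemma exists_nhds_solidCone_bounds (hd : d ≠ 0) {Ω : Set (E d)} (hΩ : HasC1Boundary Ω) {x p : E d}
    (hp : p ∈ frontier Ω) (hpx : ⟪x - p, outwardNormal Ω p⟫ < 0) {c : ℝ} (hc : 1 < c) :
    ∃ U ∈ 𝓝 p, ∀ A ⊆ U ∩ frontier Ω, MeasurableSet A →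
      d * volume (solidCone x A) ≤ ENNReal.ofReal (c ^ (2 * d)) *
        ∫⁻ y in A, ENNReal.ofReal (solidAngleDensity Ω x y)
          ∂(Measure.euclideanHausdorffMeasure (d - 1)) ∧
      ∫⁻ y in A, ENNReal.ofReal (solidAngleDensity Ω x y)
          ∂(Measure.euclideanHausdorffMeasure (d - 1)) ≤
        ENNReal.ofReal (c ^ (2 * d)) * (d * volume (solidCone x A)) := by
  set ν := -outwardNormal Ω p with hν
  set h := ⟪ν, x - p⟫ with hh
  have hpx' : 0 < h := by
    rw [hh, hν, inner_neg_left, real_inner_comm]; linarith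
  have hc0 : 0 < c := by linarith
  have hne : x - p ≠ 0 := by rintro h0; simp [h0] at hpx
  set r := ‖x - p‖ with hr
  have hr0 : 0 < r := norm_pos_iff.2 hne
  set k := solidAngleDensity Ω x p with hk
  have hkh : k = h / r ^ d := by
    rw [hk, solidAngleDensity, ← hr, real_inner_comm, ← abs_neg, ← inner_neg_left, ← hν, ← hh,
      abs_of_pos hpx']
  have hk0 : 0 < k := by rw [hkh]; positivity
  have hquot : ContinuousAt (fun y => ⟪ν, x - y⟫ / ‖x - y‖) p :=
    ContinuousAt.div (by fun_prop) (by fun_prop) hr0.ne'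
  have hhr : 0 < h / r := by positivity
  have hlow : h / (c * r) < h / r := by
    rw [mul_comm, ← div_div]; exact div_lt_self hhr hc
  have hup : h / r < c * (h / r) := by nlinarith
  have hdens : ∀ᶠ y in 𝓝 p, y ∈ frontier Ω →
      k / c < solidAngleDensity Ω x y ∧ solidAngleDensity Ω x y < c * k := by
    have hpm : p ∈ frontier Ω \ {x} := ⟨hp, fun h0 => hne (sub_eq_zero.2 (Eq.symm h0))⟩
    have h1 := continuousOn_solidAngleDensity hΩ x p hpm
    have h2 := (h1.eventually_const_lt (div_lt_self hk0 hc)).and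
      (h1.eventually_lt_const (show k < c * k by nlinarith))
    rw [eventually_nhdsWithin_iff] at h2
    have h3 : ∀ᶠ y in 𝓝 p, y ≠ x := isOpen_ne.mem_nhds hpm.2
    filter_upwards [h2, h3] with y h4 h5 h6
    exact h4 ⟨h6, h5⟩
  have hbil := eventually_rayProjection_bilipschitz hΩ hp hpx' hc
  rw [nhds_prod_eq] at hbil
  obtain ⟨V, hV, hVbil⟩ := eventually_prod_self_iff'.1 hbil
  have hW : ∀ᶠ y in 𝓝 p, y ∈ V ∧ 0 < ⟪ν, x - y⟫ ∧ y ≠ x ∧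
      h / (c * r) < ⟪ν, x - y⟫ / ‖x - y‖ ∧ ⟪ν, x - y⟫ / ‖x - y‖ < c * (h / r) ∧
      (y ∈ frontier Ω →
        k / c < solidAngleDensity Ω x y ∧ solidAngleDensity Ω x y < c * k) := by
    have hcν : ContinuousAt (fun y => ⟪ν, x - y⟫) p := by fun_prop
    filter_upwards [hV, hcν.eventually_const_lt hpx',
      isOpen_ne.mem_nhds (fun h0 => hne (sub_eq_zero.2 (Eq.symm h0))),
      hquot.eventually_const_lt hlow, hquot.eventually_lt_const hup, hdens] with y h1 h2 h3 h4 h5 h6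
    exact ⟨h1, h2, h3, h4, h5, h6⟩
  refine ⟨_, hW, fun A hAU hAm => ?_⟩
  have hAf : ∀ y ∈ A, y ∈ frontier Ω := fun y hy => (hAU hy).2
  have hAW := fun y hy => (hAU (a := y) hy).1
  have hnorm : ∀ y ∈ A, 0 < ‖x - y‖ := fun y hy =>
    norm_pos_iff.2 (sub_ne_zero.2 (Ne.symm (hAW y hy).2.2.1))
  set H : Measure (E d) := Measure.euclideanHausdorffMeasure (d - 1) with hH
  set Q := rayProjection x ν h with hQ
  have hbilA : ∀ y ∈ A, ∀ z ∈ A, dist (Q y) (Q z) ≤ c * dist y z ∧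
      dist y z ≤ c * dist (Q y) (Q z) := by
    intro y hy z hz
    rw [dist_eq_norm, dist_eq_norm]
    exact hVbil y (hAW y hy).1 z (hAW z hz).1 (hAf y hy) (hAf z hz)
  have hH1 : H (Q '' A) ≤ ENNReal.ofReal (c ^ (d - 1)) * H A :=
    euclideanHausdorffMeasure_image_le hc0.le _ fun y hy z hz => (hbilA y hy z hz).1
  have hH2 : H A ≤ ENNReal.ofReal (c ^ (d - 1)) * H (Q '' A) :=
    euclideanHausdorffMeasure_le_image hc0.le _ fun y hy z hz => (hbilA y hy z hz).2
  have hQm : MeasurableSet (Q '' A) := by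
    refine hAm.image_of_continuousOn_injOn ?_ ?_
    · intro y hy
      refine ContinuousAt.continuousWithinAt ?_
      have : ⟪ν, x - y⟫ ≠ 0 := (hAW y hy).2.1.ne'
      have h1 : ContinuousAt (fun z => h / ⟪ν, x - z⟫) y :=
        ContinuousAt.div (by fun_prop) (by fun_prop) this
      have h2 : ContinuousAt (fun z => x - z) y := by fun_prop
      exact h1.smul h2
    · intro y hy z hz hyz
      have := (hbilA y hy z hz).2
      rw [hyz, dist_self, mul_zero] at this
      exact dist_le_zero.1 this
  have hQh : ∀ w ∈ Q '' A, ⟪ν, w⟫ = h := by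
    rintro _ ⟨y, hy, rfl⟩
    exact inner_rayProjection h (hAW y hy).2.1.ne'
  have hνn : ‖ν‖ = 1 := by rw [hν, norm_neg, norm_outwardNormal hΩ hp]
  have hd0 : (0 : ℝ) < d := by positivity
  have hdd : d - 1 + 1 = d := Nat.succ_pred_eq_of_ne_zero hd
  have hcone : ∀ a : ℝ, 0 < a → (d : ENNReal) * volume {w : E d | 0 < ⟪ν, w⟫ ∧ ⟪ν, w⟫ < a ∧
      (h / ⟪ν, w⟫) • w ∈ Q '' A} = ENNReal.ofReal (a ^ d / h ^ (d - 1)) * H (Q '' A) := by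
    intro a ha
    rw [volume_truncatedCone hd hνn hpx' ha.le hQm hQh, ← mul_assoc, ← ENNReal.ofReal_natCast,
      ← ENNReal.ofReal_mul hd0.le]
    congr 2
    field_simp
  -- For b = 1 the flat cone over the tangent plane yields exactly the density k at p; the round
  -- cone is caught between b = c⁻¹ and b = c.
  have hpow : ∀ b : ℝ, (b * (h / r)) ^ d / h ^ (d - 1) = b ^ d * k := by
    intro b
    rw [hkh, mul_pow, div_pow]
    have : h ^ d = h ^ (d - 1) * h := by rw [← pow_succ, hdd]
    rw [this]
    field_simp
  have hI1 : ENNReal.ofReal k * H A ≤ ENNReal.ofReal c *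
      ∫⁻ y in A, ENNReal.ofReal (solidAngleDensity Ω x y) ∂H := by
    calc ENNReal.ofReal k * H A
        = ENNReal.ofReal c * ∫⁻ _ in A, ENNReal.ofReal (k / c) ∂H := by
          rw [setLIntegral_const, ← mul_assoc, ← ENNReal.ofReal_mul hc0.le,
            mul_div_cancel₀ _ hc0.ne']
      _ ≤ _ := by
          gcongr ENNReal.ofReal c * ?_
          refine setLIntegral_mono' hAm fun y hy => ENNReal.ofReal_le_ofReal ?_
          exact ((hAW y hy).2.2.2.2.2 (hAf y hy)).1.le
  have hI2 : ∫⁻ y in A, ENNReal.ofReal (solidAngleDensity Ω x y) ∂H ≤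
      ENNReal.ofReal (c * k) * H A := by
    rw [← setLIntegral_const]
    refine setLIntegral_mono' hAm fun y hy => ENNReal.ofReal_le_ofReal ?_
    exact ((hAW y hy).2.2.2.2.2 (hAf y hy)).2.le
  -- Losses: c^d from the height of the cone, c^(d-1) from the projection, c from the oscillation of
  -- the density.
  have hcpow : c ^ d * c ^ (d - 1) * c = c ^ (2 * d) := by
    rw [mul_assoc, ← pow_succ, hdd, ← pow_add, two_mul]
  constructor
  · calc (d : ENNReal) * volume (solidCone x A)
        ≤ d * volume {w : E d | 0 < ⟪ν, w⟫ ∧ ⟪ν, w⟫ < c * (h / r) ∧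
            (h / ⟪ν, w⟫) • w ∈ Q '' A} := by
          gcongr
          refine solidCone_subset_truncatedCone fun y hy => ⟨(hAW y hy).2.1, ?_⟩
          exact ((div_lt_iff₀ (hnorm y hy)).1 (hAW y hy).2.2.2.2.1).le
      _ = ENNReal.ofReal (c ^ d * k) * H (Q '' A) := by
          rw [hcone _ (by positivity), hpow]
      _ ≤ ENNReal.ofReal (c ^ d * k) * (ENNReal.ofReal (c ^ (d - 1)) * H A) := by gcongr
      _ = ENNReal.ofReal (c ^ d * c ^ (d - 1)) * (ENNReal.ofReal k * H A) := by
          rw [← mul_assoc, ← mul_assoc, ← ENNReal.ofReal_mul (by positivity),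
            ← ENNReal.ofReal_mul (by positivity)]
          congr 2; ring
      _ ≤ ENNReal.ofReal (c ^ d * c ^ (d - 1)) * (ENNReal.ofReal c *
            ∫⁻ y in A, ENNReal.ofReal (solidAngleDensity Ω x y) ∂H) := by gcongr
      _ = _ := by
          rw [← mul_assoc, ← ENNReal.ofReal_mul (by positivity), hcpow]
  · calc ∫⁻ y in A, ENNReal.ofReal (solidAngleDensity Ω x y) ∂H
        ≤ ENNReal.ofReal (c * k) * H A := hI2
      _ ≤ ENNReal.ofReal (c * k) * (ENNReal.ofReal (c ^ (d - 1)) * H (Q '' A)) := by gcongr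
      _ = ENNReal.ofReal (c ^ (2 * d)) * (ENNReal.ofReal ((c⁻¹) ^ d * k) * H (Q '' A)) := by
          rw [← mul_assoc, ← mul_assoc, ← ENNReal.ofReal_mul (by positivity),
            ← ENNReal.ofReal_mul (by positivity)]
          congr 2
          rw [← hcpow, inv_pow]
          field_simp
      _ = ENNReal.ofReal (c ^ (2 * d)) * (d * volume {w : E d | 0 < ⟪ν, w⟫ ∧
            ⟪ν, w⟫ < c⁻¹ * (h / r) ∧ (h / ⟪ν, w⟫) • w ∈ Q '' A}) := by
          rw [hcone _ (by positivity), hpow]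
      _ ≤ _ := by
          gcongr
          refine truncatedCone_subset_solidCone hpx' fun y hy => ⟨(hAW y hy).2.1, ?_⟩
          have h1 := (lt_div_iff₀ (hnorm y hy)).1 (hAW y hy).2.2.2.1
          have h2 : c⁻¹ * (h / r) = h / (c * r) := by field_simp
          rw [h2]
          exact h1.le

/-! ### Grazing directions are negligible -/

lemma det_eq_zero_of_inner_eq_zero {f : E d →L[ℝ] E d} {N : E d} (hN : N ≠ 0)
    (h : ∀ v, ⟪N, f v⟫ = 0) : f.det = 0 := by
  by_contra hdet
  have hsurj : Function.Surjective (f : E d →ₗ[ℝ] E d) :=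
    LinearMap.injective_iff_surjective.1
      (LinearMap.ker_eq_bot.1 (not_not.1 fun hk => hdet (LinearMap.det_eq_zero_iff_ker_ne_bot.2 hk)))
  obtain ⟨v, hv⟩ := hsurj N
  have := h v
  rw [show f v = N from hv, inner_self_eq_zero] at this
  exact hN this

/-- The graph of `Φ` above the point `w`. -/
def graphPoint (e : E d) (Φ : (ℝ ∙ e)ᗮ → ℝ) (w : E d) : E d :=
  ((ℝ ∙ e)ᗮ.orthogonalProjectionOnto w : E d) +
    Φ ((ℝ ∙ e)ᗮ.orthogonalProjectionOnto w) • e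

/-- The component of z along e, which the graph point ignores, serves as radial parameter of the
cone. The derivative takes values in the span of x - y and the tangent space at the graph point y.
If x - y is tangent, all of these are orthogonal to the normal. -/
lemma exists_hasFDerivAt_cone {e : E d} (he : ‖e‖ = 1) {Φ : (ℝ ∙ e)ᗮ → ℝ}
    (hΦ : ContDiff ℝ 1 Φ) {x w : E d} (hw : ⟪graphNormal e Φ w, x - graphPoint e Φ w⟫ = 0) :
    ∃ f : E d →L[ℝ] E d,
      HasFDerivAt (fun z => ⟪e, z⟫ • (x - graphPoint e Φ z)) f w ∧ f.det = 0 := by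
  set P := (ℝ ∙ e)ᗮ.orthogonalProjectionOnto with hP
  have h1 : HasFDerivAt Φ (fderiv ℝ Φ (P w)) (P w) :=
    (hΦ.differentiable one_ne_zero (P w)).hasFDerivAt
  have h2 : HasFDerivAt (fun z => Φ (P z)) ((fderiv ℝ Φ (P w)).comp P) w :=
    h1.comp w P.hasFDerivAt
  have h3 : HasFDerivAt (graphPoint e Φ)
      ((ℝ ∙ e)ᗮ.subtypeL.comp P + ((fderiv ℝ Φ (P w)).comp P).smulRight e) w :=
    ((ℝ ∙ e)ᗮ.subtypeL.hasFDerivAt.comp w P.hasFDerivAt).add (h2.smul_const e)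
  have h4 := (innerSL ℝ e).hasFDerivAt.smul (x := w) (h3.const_sub x)
  refine ⟨_, h4, det_eq_zero_of_inner_eq_zero (graphNormal_ne_zero he Φ w) fun v => ?_⟩
  have h5 : fderiv ℝ Φ (P w) (P v) = ⟪gradient Φ (P w), P v⟫ := by simp [gradient]
  have h6 : ∀ u : (ℝ ∙ e)ᗮ, ⟪e, (u : E d)⟫ = 0 := fun u =>
    Submodule.mem_orthogonal_singleton_iff_inner_right.1 u.2
  have h7 : ⟪graphNormal e Φ w, (P v : E d) + fderiv ℝ Φ (P w) (P v) • e⟫ = 0 := by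
    rw [graphNormal, ← hP, inner_sub_left, inner_add_right, inner_add_right,
      real_inner_smul_right, real_inner_smul_right, h6, real_inner_comm, real_inner_comm e, h6,
      real_inner_self_eq_norm_sq, he, h5, Submodule.coe_inner, real_inner_comm]
    ring
  simp only [_root_.add_apply, _root_.smul_apply, _root_.neg_apply,
    ContinuousLinearMap.smulRight_apply, ContinuousLinearMap.comp_apply, innerSL_apply_apply,
    Submodule.subtypeL_apply, inner_add_right, real_inner_smul_right, inner_neg_right, hw] at h7 ⊢
  linear_combination (-⟪e, w⟫) * h7

lemma IsLocalEpigraph.graphPoint_eq {Ω : Set (E d)} {y e : E d} {Φ : (ℝ ∙ e)ᗮ → ℝ}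
    (h : IsLocalEpigraph Ω y e Φ) (hy : y ∈ frontier Ω) : graphPoint e Φ y = y := by
  rw [graphPoint, h.apply_eq hy]
  have h1 := (ℝ ∙ e).starProjection_add_starProjection_orthogonal y
  have h2 : (ℝ ∙ e).starProjection y = ⟪e, y⟫ • e :=
    Submodule.starProjection_unit_singleton ℝ h.norm_eq y
  rw [h2] at h1
  rw [add_comm]
  exact h1

/-- The grazing directions, those of the segments from `x` tangent to the boundary, are
negligible. -/
lemma volume_solidCone_grazing {Ω : Set (E d)} (hΩ : HasC1Boundary Ω) (x : E d) :
    volume (solidCone x {y | y ∈ frontier Ω ∧ ⟪x - y, outwardNormal Ω y⟫ = 0}) = 0 := by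
  set C : Set (E d) := {y | y ∈ frontier Ω ∧ ⟪x - y, outwardNormal Ω y⟫ = 0} with hC
  have hloc : ∀ p ∈ frontier Ω, ∃ U ∈ 𝓝 p, volume (solidCone x (C ∩ U)) = 0 := by
    intro p hp
    obtain ⟨e, Φ, h⟩ := hΩ p hp
    refine ⟨_, h.eventually, ?_⟩
    set S : Set (E d) := {w | ⟪graphNormal e Φ w, x - graphPoint e Φ w⟫ = 0} with hS
    choose! f' hf' hdet using fun w (hw : w ∈ S) => exists_hasFDerivAt_cone h.norm_eq h.contDiff hw
    have hnull := addHaar_image_eq_zero_of_det_fderivWithin_eq_zero (volume : Measure (E d))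
      (fun w hw => (hf' w hw).hasFDerivWithinAt) hdet
    refine measure_mono_null ?_ hnull
    rintro _ ⟨t, -, y, ⟨⟨hyf, hy0⟩, hy⟩, rfl⟩
    set P := (ℝ ∙ e)ᗮ.orthogonalProjectionOnto with hP
    -- Same graph point as y, with the e-component equal to the scale that carries x - y to the
    -- given point of the cone.
    set w : E d := (P y : E d) + (t * ‖x - y‖⁻¹) • e with hw
    have hPw : P w = P y := by
      have : P e = 0 := Submodule.orthogonalProjectionOnto_orthogonalComplement_singleton_eq_zero e
      rw [hw, map_add, map_smul, this, smul_zero, add_zero]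
      exact Submodule.orthogonalProjectionOnto_mem_subspace_eq_self _
    have hew : ⟪e, w⟫ = t * ‖x - y‖⁻¹ := by
      rw [hw, inner_add_right, Submodule.mem_orthogonal_singleton_iff_inner_right.1 (P y).2,
        real_inner_smul_right, real_inner_self_eq_norm_sq, h.norm_eq]
      ring
    have hgp : graphPoint e Φ w = y := by
      have h1 : graphPoint e Φ w = graphPoint e Φ y := by
        rw [graphPoint, graphPoint, ← hP, hPw]
      rw [h1, IsLocalEpigraph.graphPoint_eq hy hyf]
    have hgn : graphNormal e Φ w = graphNormal e Φ y := by
      rw [graphNormal, graphNormal, ← hP, hPw]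
    refine ⟨w, ?_, ?_⟩
    · rw [hS, mem_ofPred_eq, hgp, hgn, IsLocalEpigraph.graphNormal_eq hy hyf,
        real_inner_smul_left, real_inner_comm, hy0, mul_zero]
    · simp only [hgp, hew, smul_smul]
  choose! U hU hnull using hloc
  obtain ⟨s, hsf, hs, hcov⟩ := TopologicalSpace.countable_cover_nhdsWithin
    (fun p hp => mem_nhdsWithin_of_mem_nhds (hU p hp))
  refine measure_mono_null ?_ ((measure_biUnion_null_iff hs).2 fun p hp => hnull p (hsf hp))
  rintro _ ⟨t, ht, y, hy, rfl⟩
  obtain ⟨p, hp, hyp⟩ := mem_iUnion₂.1 (hcov hy.1)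
  exact mem_iUnion₂.2 ⟨p, hp, t, ht, y, ⟨hy, hyp⟩, rfl⟩

/-! ### Measurability and the direction map -/

lemma measurable_outwardNormal {Ω : Set (E d)} (hΩ : HasC1Boundary Ω) :
    Measurable (outwardNormal Ω) := by
  classical
  -- Off the frontier the normal takes its default value 0.
  have h1 : (frontier Ω).piecewise (outwardNormal Ω) (fun _ => 0) = outwardNormal Ω := by
    ext1 p
    by_cases hp : p ∈ frontier Ω
    · rw [piecewise_eq_of_mem _ _ _ hp]
    · rw [piecewise_eq_of_notMem _ _ _ hp, outwardNormal, dif_neg]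
      rintro ⟨ν, hν⟩
      exact hp hν.1
  rw [← h1]
  exact (continuousOn_outwardNormal hΩ).measurable_piecewise continuousOn_const
    isClosed_frontier.measurableSet

lemma measurable_solidAngleDensity {Ω : Set (E d)} (hΩ : HasC1Boundary Ω) (x : E d) :
    Measurable (solidAngleDensity Ω x) := by
  have h1 := measurable_outwardNormal hΩ
  have h2 : Measurable fun y => ⟪x - y, outwardNormal Ω y⟫ :=
    (measurable_const.sub measurable_id).inner h1
  exact (continuous_abs.measurable.comp h2).div
    ((measurable_const.sub measurable_id).norm.pow_const d)

/-- The open segment is exhausted by compact subsegments, and for each of them containment in the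
open set Ω is an open condition on y. -/
lemma measurableSet_openSegment_subset {Ω : Set (E d)} (hΩo : IsOpen Ω) (x : E d) :
    MeasurableSet {y | openSegment ℝ x y ⊆ Ω} := by
  have h1 : {y | openSegment ℝ x y ⊆ Ω} =
      ⋂ n : ℕ, {y | ∀ t ∈ Icc (1 / ((n : ℝ) + 1)) (1 - 1 / ((n : ℝ) + 1)),
        x + t • (y - x) ∈ Ω} := by
    ext y
    simp only [mem_ofPred_eq, mem_iInter, openSegment_eq_image', image_subset_iff]
    constructor
    · intro h n t ht
      have hn : 0 < 1 / ((n : ℝ) + 1) := by positivity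
      exact h ⟨hn.trans_le ht.1, ht.2.trans_lt (by linarith)⟩
    · rintro h t ⟨ht0, ht1⟩
      obtain ⟨n, hn⟩ := exists_nat_one_div_lt (lt_min ht0 (sub_pos.2 ht1))
      have h2 := lt_min_iff.1 hn
      exact h n t ⟨h2.1.le, by linarith [h2.2]⟩
  rw [h1]
  refine MeasurableSet.iInter fun n => IsOpen.measurableSet ?_
  rw [isOpen_iff_eventually]
  intro y hy
  refine isCompact_Icc.eventually_forall_of_forall_eventually fun t ht => ?_
  have hc : Continuous fun z : E d × ℝ => x + z.2 • (z.1 - x) := by fun_prop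
  exact hc.continuousAt.eventually (hΩo.mem_nhds (hy t ht))

lemma measurableSet_visibleBoundary {Ω : Set (E d)} (hΩo : IsOpen Ω) (hΩ : HasC1Boundary Ω)
    (x : E d) : MeasurableSet (visibleBoundary Ω x) := by
  have h1 := measurable_outwardNormal hΩ
  have h2 : Measurable fun y => ⟪x - y, outwardNormal Ω y⟫ :=
    (measurable_const.sub measurable_id).inner h1
  have h3 : Measurable fun y => ⟪x - y, outwardNormal Ω x⟫ :=
    (measurable_const.sub measurable_id).inner measurable_const
  exact isClosed_frontier.measurableSet.inter ((measurableSet_openSegment_subset hΩo x).inter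
    ((measurableSet_lt measurable_const h3).inter (measurableSet_lt h2 measurable_const)))

lemma ne_of_mem_visibleBoundary {Ω : Set (E d)} {x y : E d} (hy : y ∈ visibleBoundary Ω x) :
    x - y ≠ 0 := by
  intro h0
  have h1 := hy.2.2.1
  rw [h0, inner_zero_left] at h1
  exact lt_irrefl _ h1

/-- The direction `(x - y) / |x - y|` in which `x` is seen from a visible boundary point `y`. -/
def visibleDirection (Ω : Set (E d)) (x : E d) (y : visibleBoundary Ω x) :
    Metric.sphere (0 : E d) 1 :=
  ⟨‖x - y‖⁻¹ • (x - y), by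
    rw [mem_sphere_zero_iff_norm]
    exact norm_smul_inv_norm (ne_of_mem_visibleBoundary y.2)⟩

lemma travelTime_visibleDirection {Ω : Set (E d)} (hΩo : IsOpen Ω) (x : E d)
    (y : visibleBoundary Ω x) : travelTime Ω x (visibleDirection Ω x y) = ‖x - y‖ := by
  have hne := ne_of_mem_visibleBoundary y.2
  have hpos : 0 < ‖x - y‖ := norm_pos_iff.2 hne
  have hΩy : (y : E d) ∉ Ω := by
    have := y.2.1
    rw [hΩo.frontier_eq] at this
    exact this.2
  refine IsLeast.csInf_eq ⟨⟨hpos, ?_⟩, fun s hs => not_lt.1 fun hlt => hs.2 ?_⟩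
  · rw [visibleDirection, smul_inv_smul₀ hpos.ne', sub_sub_cancel]
    exact hΩy
  · refine y.2.2.1 ?_
    rw [openSegment_eq_image']
    refine ⟨s / ‖x - y‖, ⟨div_pos hs.1 hpos, (div_lt_one hpos).2 hlt⟩, ?_⟩
    simp only [visibleDirection]
    rw [smul_smul, ← div_eq_mul_inv, ← neg_sub x (y : E d), smul_neg, ← sub_eq_add_neg]

lemma sub_travelTime_smul_visibleDirection {Ω : Set (E d)} (hΩo : IsOpen Ω) (x : E d)
    (y : visibleBoundary Ω x) :
    x - travelTime Ω x (visibleDirection Ω x y) • (visibleDirection Ω x y : E d) = y := by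
  have hpos : 0 < ‖x - y‖ := norm_pos_iff.2 (ne_of_mem_visibleBoundary y.2)
  rw [travelTime_visibleDirection hΩo, visibleDirection, smul_inv_smul₀ hpos.ne', sub_sub_cancel]

/-- The map is continuous, and injective because σ ↦ x - τ₋σ inverts it; the Lusin–Souslin theorem
on the standard Borel space Σ₊(x) does the rest. -/
lemma measurableEmbedding_visibleDirection {Ω : Set (E d)} (hΩo : IsOpen Ω)
    (hΩ : HasC1Boundary Ω) (x : E d) : MeasurableEmbedding (visibleDirection Ω x) := by
  have : StandardBorelSpace (visibleBoundary Ω x) :=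
    (measurableSet_visibleBoundary hΩo hΩ x).standardBorel
  refine Measurable.measurableEmbedding (Continuous.measurable ?_) ?_
  · refine Continuous.subtype_mk ?_ _
    have h1 : Continuous fun y : visibleBoundary Ω x => x - (y : E d) := by fun_prop
    exact (h1.norm.inv₀ fun y => norm_ne_zero_iff.2 (ne_of_mem_visibleBoundary y.2)).smul h1
  · intro y z hyz
    have h1 := sub_travelTime_smul_visibleDirection hΩo x y
    rw [hyz, sub_travelTime_smul_visibleDirection hΩo x z] at h1
    exact Subtype.ext h1.symm

/-! ### Exit points of rays and the half sphere -/

/-- The backward ray issued from a boundary point into `Ω` first meets the boundary at the time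
`τ₋`, and it does so from inside. -/
lemma travelTime_spec {Ω : Set (E d)} (hΩo : IsOpen Ω) (hΩb : Bornology.IsBounded Ω)
    (hΩ : HasC1Boundary Ω) {x : E d} (hx : x ∈ frontier Ω) {σ : E d} (hσ : ‖σ‖ = 1)
    (hσx : 0 < ⟪σ, outwardNormal Ω x⟫) :
    0 < travelTime Ω x σ ∧ (∀ s ∈ Ioo 0 (travelTime Ω x σ), x - s • σ ∈ Ω) ∧
      x - travelTime Ω x σ • σ ∈ frontier Ω ∧
      ⟪σ, outwardNormal Ω (x - travelTime Ω x σ • σ)⟫ ≤ 0 := by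
  set T : Set ℝ := {s : ℝ | 0 < s ∧ x - s • σ ∉ Ω} with hT
  set τ := travelTime Ω x σ with hτ
  have hτT : τ = sInf T := rfl
  have hbdd : BddBelow T := ⟨0, fun s hs => hs.1.le⟩
  have hne : T.Nonempty := by
    obtain ⟨R, hR⟩ := hΩb.exists_norm_le
    -- By this time the ray has left the ball of radius R that contains Ω.
    refine ⟨|R| + ‖x‖ + 1, by positivity, fun hmem => ?_⟩
    have h1 := hR _ hmem
    have h2 : ‖(|R| + ‖x‖ + 1) • σ‖ ≤ ‖x‖ + ‖x - (|R| + ‖x‖ + 1) • σ‖ := by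
      simpa using norm_sub_le x (x - (|R| + ‖x‖ + 1) • σ)
    rw [norm_smul, hσ, mul_one, Real.norm_eq_abs, abs_of_pos (by positivity)] at h2
    linarith [le_abs_self R]
  have hin : ∀ s ∈ Ioo 0 τ, x - s • σ ∈ Ω := by
    intro s hs
    by_contra hcon
    exact notMem_of_lt_csInf (hτT ▸ hs.2) hbdd ⟨hs.1, hcon⟩
  have hpos : 0 < τ := by
    have h1 : ∀ᶠ t : ℝ in 𝓝[>] 0, x + t • (-σ) ∈ Ω := by
      refine (eventually_ray hΩ hx (-σ)).1 ?_
      rw [inner_neg_right, real_inner_comm]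
      linarith
    obtain ⟨ε, hε, hsub⟩ := mem_nhdsGT_iff_exists_Ioo_subset.1 h1
    refine lt_of_lt_of_le hε (hτT ▸ le_csInf hne fun s hs => not_lt.1 fun hlt => hs.2 ?_)
    have := hsub ⟨hs.1, hlt⟩
    simpa [sub_eq_add_neg] using this
  have hc : Continuous fun s : ℝ => x - s • σ := by fun_prop
  have hout : x - τ • σ ∉ Ω := by
    have hcl : IsClosed {s : ℝ | x - s • σ ∈ Ωᶜ} := hΩo.isClosed_compl.preimage hc
    have h1 : closure T ⊆ {s : ℝ | x - s • σ ∈ Ωᶜ} :=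
      closure_minimal (fun s hs => hs.2) hcl
    exact h1 (hτT ▸ csInf_mem_closure hne hbdd)
  have hfr : x - τ • σ ∈ frontier Ω := by
    rw [hΩo.frontier_eq]
    refine ⟨?_, hout⟩
    have h1 : τ ∈ closure (Ioo 0 τ) := by
      rw [closure_Ioo hpos.ne]
      exact right_mem_Icc.2 hpos.le
    exact map_mem_closure (f := fun s : ℝ => x - s • σ) hc h1 hin
  -- Were the product positive, moving from the exit point back towards x along σ would leave Ω at
  -- once, yet those points lie on the part of the ray inside Ω.
  refine ⟨hpos, hin, hfr, not_lt.1 fun hlt => ?_⟩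
  rw [real_inner_comm] at hlt
  obtain ⟨t, ht, htτ⟩ := (((eventually_ray hΩ hfr σ).2 hlt).and
    (Ioo_mem_nhdsGT hpos)).exists
  refine ht ?_
  have h1 := hin (τ - t) ⟨by linarith [htτ.2], by linarith [htτ.1]⟩
  rwa [sub_smul, ← sub_add] at h1

/-- A direction entering `Ω` at `x` either comes from a visible boundary point, or is grazing. -/
lemma mem_range_visibleDirection_or {Ω : Set (E d)} (hΩo : IsOpen Ω)
    (hΩb : Bornology.IsBounded Ω) (hΩ : HasC1Boundary Ω) {x : E d} (hx : x ∈ frontier Ω)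
    {σ : Metric.sphere (0 : E d) 1} (hσ : σ ∈ halfSphere Ω x) :
    σ ∈ range (visibleDirection Ω x) ∨
      ∃ y ∈ frontier Ω, ⟪x - y, outwardNormal Ω y⟫ = 0 ∧ (σ : E d) = ‖x - y‖⁻¹ • (x - y) := by
  have hn : ‖(σ : E d)‖ = 1 := mem_sphere_zero_iff_norm.1 σ.2
  obtain ⟨hpos, hin, hfr, hle⟩ := travelTime_spec hΩo hΩb hΩ hx hn hσ
  set τ := travelTime Ω x σ
  set y := x - τ • (σ : E d) with hy
  have hxy : x - y = τ • (σ : E d) := sub_sub_cancel _ _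
  have hnorm : ‖x - y‖ = τ := by
    rw [hxy, norm_smul, hn, mul_one, Real.norm_eq_abs, abs_of_pos hpos]
  have hσy : (σ : E d) = ‖x - y‖⁻¹ • (x - y) := by
    rw [hnorm, hxy, inv_smul_smul₀ hpos.ne']
  rcases hle.lt_or_eq with hlt | heq
  · left
    refine ⟨⟨y, hfr, ?_, ?_, ?_⟩, Subtype.ext hσy.symm⟩
    · rw [openSegment_eq_image']
      rintro _ ⟨t, ht, rfl⟩
      have h1 := hin (t * τ) ⟨mul_pos ht.1 hpos, by nlinarith [ht.2]⟩
      have h2 : x + t • (y - x) = x - (t * τ) • (σ : E d) := by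
        rw [← neg_sub x y, hxy, smul_neg, smul_smul, sub_eq_add_neg]
      simp only [h2, h1]
    · rw [hxy, real_inner_smul_left]
      exact mul_pos hpos hσ
    · rw [hxy, real_inner_smul_left]
      exact mul_neg_of_pos_of_neg hpos hlt
  · right
    refine ⟨y, hfr, ?_, hσy⟩
    rw [hxy, real_inner_smul_left, heq, mul_zero]

lemma sphereMeasure_apply {s : Set (Metric.sphere (0 : E d) 1)} (hs : MeasurableSet s) (x : E d)
    {A : Set (E d)} (hA : ((↑) : _ → E d) '' s = (fun y => ‖x - y‖⁻¹ • (x - y)) '' A) :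
    sphereMeasure d s = d * volume (solidCone x A) := by
  rw [sphereMeasure, Measure.toSphere_apply' _ hs, hA]
  congr 2
  · simp
  · ext w
    rw [Set.mem_smul]
    constructor
    · rintro ⟨t, ht, _, ⟨y, hy, rfl⟩, rfl⟩
      exact ⟨t, ht, y, hy, rfl⟩
    · rintro ⟨t, ht, y, hy, rfl⟩
      exact ⟨t, ht, _, ⟨y, hy, rfl⟩, rfl⟩

/-- A direction of the half sphere that is missed must be grazing, and the cone of grazing
directions has volume zero. -/
lemma sphereMeasure_halfSphere_diff {Ω : Set (E d)} (hΩo : IsOpen Ω)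
    (hΩb : Bornology.IsBounded Ω) (hΩ : HasC1Boundary Ω) {x : E d} (hx : x ∈ frontier Ω) :
    sphereMeasure d (halfSphere Ω x \ range (visibleDirection Ω x)) = 0 := by
  have hm : MeasurableSet (halfSphere Ω x \ range (visibleDirection Ω x)) := by
    refine MeasurableSet.diff ?_ (measurableEmbedding_visibleDirection hΩo hΩ x).measurableSet_range
    refine (isOpen_lt continuous_const ?_).measurableSet
    fun_prop
  rw [sphereMeasure, Measure.toSphere_apply' _ hm]
  refine mul_eq_zero_of_right _ (measure_mono_null ?_ (volume_solidCone_grazing hΩ x))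
  rintro _ ⟨t, ht, _, ⟨σ, ⟨hσ, hσr⟩, rfl⟩, rfl⟩
  rcases mem_range_visibleDirection_or hΩo hΩb hΩ hx hσ with h | ⟨y, hy, h0, hσy⟩
  · exact absurd h hσr
  · exact ⟨t, ht, y, ⟨hy, h0⟩, by rw [hσy]⟩

/-! ### Identification of the measures -/

/-- The solid angle measure of the visible part of the boundary. -/
lemma comap_visibleDirection_sphereMeasure (hd : d ≠ 0) {Ω : Set (E d)} (hΩo : IsOpen Ω)
    (hΩ : HasC1Boundary Ω) (x : E d) :
    (sphereMeasure d).comap (visibleDirection Ω x) =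
      ((surfaceMeasure Ω).comap ((↑) : visibleBoundary Ω x → E d)).withDensity
        fun y => ((solidAngleDensity Ω x y).toNNReal : ENNReal) := by
  have hvis := measurableSet_visibleBoundary hΩo hΩ x
  have hval : MeasurableEmbedding ((↑) : visibleBoundary Ω x → E d) := .subtype_coe hvis
  have hemb := measurableEmbedding_visibleDirection hΩo hΩ x
  have h1 : ∀ A : Set (visibleBoundary Ω x), MeasurableSet A →
      (sphereMeasure d).comap (visibleDirection Ω x) A =
        d * volume (solidCone x ((↑) '' A)) := by
    intro A hA
    rw [hemb.comap_apply]
    refine sphereMeasure_apply (hemb.measurableSet_image.2 hA) x ?_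
    rw [image_image, image_image]
    rfl
  have h2 : ∀ A : Set (visibleBoundary Ω x), MeasurableSet A →
      ((surfaceMeasure Ω).comap ((↑) : visibleBoundary Ω x → E d)).withDensity
        (fun y => ((solidAngleDensity Ω x y).toNNReal : ENNReal)) A =
      ∫⁻ y in (↑) '' A, ENNReal.ofReal (solidAngleDensity Ω x y)
        ∂(Measure.euclideanHausdorffMeasure (d - 1)) := by
    intro A hA
    rw [withDensity_apply _ hA]
    have h3 : ((↑) : visibleBoundary Ω x → E d) '' A ⊆ frontier Ω := by
      rintro _ ⟨y, -, rfl⟩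
      exact y.2.1
    have h4 := setLIntegral_subtype (μ := surfaceMeasure Ω) hvis A
      fun y => ENNReal.ofReal (solidAngleDensity Ω x y)
    rw [surfaceMeasure, Measure.restrict_restrict_of_subset h3] at h4
    exact h4
  have hloc : ∀ c : ℝ, 1 < c → ∀ p : visibleBoundary Ω x, ∃ U ∈ 𝓝 p, ∀ A ⊆ U, MeasurableSet A →
      (sphereMeasure d).comap (visibleDirection Ω x) A ≤ ENNReal.ofReal (c ^ (2 * d)) *
        ((surfaceMeasure Ω).comap ((↑) : visibleBoundary Ω x → E d)).withDensity
          (fun y => ((solidAngleDensity Ω x y).toNNReal : ENNReal)) A ∧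
      ((surfaceMeasure Ω).comap ((↑) : visibleBoundary Ω x → E d)).withDensity
          (fun y => ((solidAngleDensity Ω x y).toNNReal : ENNReal)) A ≤
        ENNReal.ofReal (c ^ (2 * d)) * (sphereMeasure d).comap (visibleDirection Ω x) A := by
    intro c hc p
    obtain ⟨U, hU, hb⟩ := exists_nhds_solidCone_bounds hd hΩ p.2.1 p.2.2.2.2 hc
    refine ⟨(↑) ⁻¹' U, continuous_subtype_val.continuousAt.preimage_mem_nhds hU, fun A hA hAm => ?_⟩
    rw [h1 A hAm, h2 A hAm]
    refine hb _ ?_ (hval.measurableSet_image.2 hAm)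
    rintro _ ⟨y, hy, rfl⟩
    exact ⟨hA hy, y.2.1⟩
  refine le_antisymm (measure_le_of_locally_le_pow (2 * d) fun c hc p => ?_)
    (measure_le_of_locally_le_pow (2 * d) fun c hc p => ?_)
  · obtain ⟨U, hU, h⟩ := hloc c hc p
    exact ⟨U, hU, fun A hA hAm => (h A hA hAm).1⟩
  · obtain ⟨U, hU, h⟩ := hloc c hc p
    exact ⟨U, hU, fun A hA hAm => (h A hA hAm).2⟩

/-- The surface measure of the half sphere at `x` is the image, under the direction map, of the
surface measure of the visible boundary weighted by the solid angle density. -/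
theorem restrict_halfSphere_eq_map (hd : d ≠ 0) {Ω : Set (E d)} (hΩo : IsOpen Ω)
    (hΩb : Bornology.IsBounded Ω) (hΩ : HasC1Boundary Ω) {x : E d} (hx : x ∈ frontier Ω) :
    (sphereMeasure d).restrict (halfSphere Ω x) =
      (((surfaceMeasure Ω).comap ((↑) : visibleBoundary Ω x → E d)).withDensity
        fun y => ((solidAngleDensity Ω x y).toNNReal : ENNReal)).map (visibleDirection Ω x) := by
  rw [← comap_visibleDirection_sphereMeasure hd hΩo hΩ x,
    (measurableEmbedding_visibleDirection hΩo hΩ x).map_comap]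
  refine Measure.restrict_congr_set (EventuallyLE.antisymm ?_ (LE.le.eventuallyLE ?_))
  · exact ae_le_set.2 (sphereMeasure_halfSphere_diff hΩo hΩb hΩ hx)
  · rintro _ ⟨y, rfl⟩
    have hpos : 0 < ‖x - y‖ := norm_pos_iff.2 (ne_of_mem_visibleBoundary y.2)
    change 0 < ⟪‖x - y‖⁻¹ • (x - (y : E d)), outwardNormal Ω x⟫
    rw [real_inner_smul_left]
    exact mul_pos (inv_pos.2 hpos) y.2.2.2.1

/-- Normalizing x - y in the factor at x accounts for the exponent d + 1 in place of d. -/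
lemma kernelJ_eq {Ω : Set (E d)} {x : E d} (y : visibleBoundary Ω x) :
    kernelJ Ω x y = solidAngleDensity Ω x y *
      |⟪(visibleDirection Ω x y : E d), outwardNormal Ω x⟫| := by
  have hpos : 0 < ‖x - y‖ := norm_pos_iff.2 (ne_of_mem_visibleBoundary y.2)
  rw [kernelJ, indicator_of_mem y.2, solidAngleDensity, visibleDirection, real_inner_smul_left,
    abs_mul, abs_of_pos (inv_pos.2 hpos), pow_succ]
  field_simp

/-! ### Transfer of integrals -/

section ChangeOfVariables

variable {Ω : Set (E d)} {x : E d}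

lemma lintegral_halfSphere (hd : d ≠ 0) (hΩo : IsOpen Ω) (hΩb : Bornology.IsBounded Ω)
    (hΩ : HasC1Boundary Ω) (hx : x ∈ frontier Ω) {f : Metric.sphere (0 : E d) 1 → ℝ}
    {F : E d → ℝ} (hF : ∀ y : visibleBoundary Ω x,
      F y = solidAngleDensity Ω x y * f (visibleDirection Ω x y)) :
    ∫⁻ σ in halfSphere Ω x, ENNReal.ofReal (f σ) ∂(sphereMeasure d) =
      ∫⁻ y in visibleBoundary Ω x, ENNReal.ofReal (F y) ∂(surfaceMeasure Ω) := by
  have hk : Measurable fun y : visibleBoundary Ω x =>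
      ((solidAngleDensity Ω x y).toNNReal : ENNReal) :=
    ((measurable_solidAngleDensity hΩ x).comp measurable_subtype_coe).real_toNNReal.coe_nnreal_ennreal
  rw [restrict_halfSphere_eq_map hd hΩo hΩb hΩ hx,
    (measurableEmbedding_visibleDirection hΩo hΩ x).lintegral_map,
    lintegral_withDensity_eq_lintegral_mul_non_measurable _ hk
      (Eventually.of_forall fun _ => ENNReal.coe_lt_top),
    ← lintegral_subtype_comap (measurableSet_visibleBoundary hΩo hΩ x)]
  refine lintegral_congr fun y => ?_
  rw [hF y, ENNReal.ofReal_mul (solidAngleDensity_nonneg Ω x y)]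
  rfl

variable {f : Metric.sphere (0 : E d) 1 → ℂ} {F : E d → ℂ}

lemma integrableOn_halfSphere_iff (hd : d ≠ 0) (hΩo : IsOpen Ω) (hΩb : Bornology.IsBounded Ω)
    (hΩ : HasC1Boundary Ω) (hx : x ∈ frontier Ω) (hF : ∀ y : visibleBoundary Ω x,
      F y = (solidAngleDensity Ω x y : ℂ) * f (visibleDirection Ω x y)) :
    IntegrableOn f (halfSphere Ω x) (sphereMeasure d) ↔
      IntegrableOn F (visibleBoundary Ω x) (surfaceMeasure Ω) := by
  have hk : Measurable fun y : visibleBoundary Ω x => (solidAngleDensity Ω x y).toNNReal :=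
    ((measurable_solidAngleDensity hΩ x).comp measurable_subtype_coe).real_toNNReal
  rw [IntegrableOn, restrict_halfSphere_eq_map hd hΩo hΩb hΩ hx,
    (measurableEmbedding_visibleDirection hΩo hΩ x).integrable_map_iff,
    integrable_withDensity_iff_integrable_smul hk,
    integrableOn_iff_comap_subtypeVal (measurableSet_visibleBoundary hΩo hΩ x)]
  refine iff_of_eq (congrArg (fun u => Integrable u _) ?_)
  ext1 y
  rw [Function.comp_apply, Function.comp_apply, hF y, NNReal.smul_def,
    Real.coe_toNNReal _ (solidAngleDensity_nonneg Ω x y), Complex.real_smul]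

lemma integral_halfSphere (hd : d ≠ 0) (hΩo : IsOpen Ω) (hΩb : Bornology.IsBounded Ω)
    (hΩ : HasC1Boundary Ω) (hx : x ∈ frontier Ω) (hF : ∀ y : visibleBoundary Ω x,
      F y = (solidAngleDensity Ω x y : ℂ) * f (visibleDirection Ω x y)) :
    ∫ σ in halfSphere Ω x, f σ ∂(sphereMeasure d) =
      ∫ y in visibleBoundary Ω x, F y ∂(surfaceMeasure Ω) := by
  have hk : Measurable fun y : visibleBoundary Ω x => (solidAngleDensity Ω x y).toNNReal :=
    ((measurable_solidAngleDensity hΩ x).comp measurable_subtype_coe).real_toNNReal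
  rw [restrict_halfSphere_eq_map hd hΩo hΩb hΩ hx,
    (measurableEmbedding_visibleDirection hΩo hΩ x).integral_map,
    integral_withDensity_eq_integral_smul hk,
    ← integral_subtype_comap (measurableSet_visibleBoundary hΩo hΩ x)]
  refine integral_congr_ae (Eventually.of_forall fun y => ?_)
  simp only [hF y, NNReal.smul_def,
    Real.coe_toNNReal _ (solidAngleDensity_nonneg Ω x y), Complex.real_smul]

end ChangeOfVariables

end BoundaryTransport

end

open BoundaryTransport in
/-- The functions `g` on the sphere and `G` on `∂Ω` are given as functions on `ℝ^d` of which only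
the restrictions to the sphere and to `∂Ω` matter, and `φ` is a function on `ℝ` of which only the
values at positive reals matter. Integrals of nonnegative functions take values in `[0, ∞]`. -/
theorem lemma6p3 (d : ℕ) (hd : 2 ≤ d) (Ω : Set (E d))
    (hΩo : IsOpen Ω) (hΩb : Bornology.IsBounded Ω) (hΩ : HasC1Boundary Ω)
    (x : E d) (hx : x ∈ frontier Ω) :
    (∀ g : E d → ℝ,
      Measurable ((Metric.sphere (0 : E d) 1).domRestrict g) →
      (∀ σ ∈ Metric.sphere (0 : E d) 1, 0 ≤ g σ) →
      ∫⁻ σ in halfSphere Ω x,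
          ENNReal.ofReal (g σ * |⟪(σ : E d), outwardNormal Ω x⟫|)
          ∂(sphereMeasure d) =
        ∫⁻ y, ENNReal.ofReal (g (‖x - y‖⁻¹ • (x - y)) * kernelJ Ω x y) ∂(surfaceMeasure Ω)) ∧
    (∀ (G : E d → ℝ) (φ : ℝ → ℂ),
      Measurable ((frontier Ω).domRestrict G) → (∀ y ∈ frontier Ω, 0 ≤ G y) →
      Measurable ((Set.Ioi (0 : ℝ)).domRestrict φ) →
      -- the identity for the modulus of `φ`, in `[0, ∞]`
      (∫⁻ σ in halfSphere Ω x,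
          ENNReal.ofReal (|⟪(σ : E d), outwardNormal Ω x⟫| *
            ‖φ (travelTime Ω x σ)‖ *
            G (x - travelTime Ω x σ • (σ : E d))) ∂(sphereMeasure d) =
        ∫⁻ y in visibleBoundary Ω x,
          ENNReal.ofReal (G y * ‖φ ‖x - y‖‖ * kernelJ Ω x y) ∂(surfaceMeasure Ω)) ∧
      -- both sides are absolutely convergent at the same time, and they are equal
      (IntegrableOn (fun σ : Metric.sphere (0 : E d) 1 =>
          ((|⟪(σ : E d), outwardNormal Ω x⟫| : ℝ) : ℂ) *
            φ (travelTime Ω x σ) *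
            (G (x - travelTime Ω x σ • (σ : E d)) : ℂ))
          (halfSphere Ω x) (sphereMeasure d) ↔
        IntegrableOn (fun y => (G y : ℂ) * φ ‖x - y‖ * (kernelJ Ω x y : ℂ))
          (visibleBoundary Ω x) (surfaceMeasure Ω)) ∧
      (∫ σ in halfSphere Ω x,
          ((|⟪(σ : E d), outwardNormal Ω x⟫| : ℝ) : ℂ) *
            φ (travelTime Ω x σ) *
            (G (x - travelTime Ω x σ • (σ : E d)) : ℂ) ∂(sphereMeasure d) =
        ∫ y in visibleBoundary Ω x,
          (G y : ℂ) * φ ‖x - y‖ * (kernelJ Ω x y : ℂ) ∂(surfaceMeasure Ω))) := by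
  have hd0 : d ≠ 0 := by omega
  have hvis := measurableSet_visibleBoundary hΩo hΩ x
  refine ⟨fun g _ _ => ?_, fun G φ _ _ _ => ⟨?_, ?_, ?_⟩⟩
  -- The kernel vanishes off Σ₊(x), so the integral over ∂Ω is one over the visible part.
  · have hsupp : (fun y => ENNReal.ofReal (g (‖x - y‖⁻¹ • (x - y)) * kernelJ Ω x y)) =
        (visibleBoundary Ω x).indicator
          fun y => ENNReal.ofReal (g (‖x - y‖⁻¹ • (x - y)) * kernelJ Ω x y) := by
      ext1 y
      by_cases hy : y ∈ visibleBoundary Ω x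
      · rw [indicator_of_mem hy]
      · rw [indicator_of_notMem hy, kernelJ, indicator_of_notMem hy, mul_zero, ENNReal.ofReal_zero]
    rw [hsupp, lintegral_indicator hvis]
    refine lintegral_halfSphere hd0 hΩo hΩb hΩ hx fun y => ?_
    rw [kernelJ_eq y, visibleDirection]
    ring
  · refine lintegral_halfSphere hd0 hΩo hΩb hΩ hx fun y => ?_
    rw [sub_travelTime_smul_visibleDirection hΩo, travelTime_visibleDirection hΩo, kernelJ_eq y]
    ring
  · refine integrableOn_halfSphere_iff hd0 hΩo hΩb hΩ hx fun y => ?_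
    rw [sub_travelTime_smul_visibleDirection hΩo, travelTime_visibleDirection hΩo, kernelJ_eq y]
    push_cast
    ring
  · refine integral_halfSphere hd0 hΩo hΩb hΩ hx fun y => ?_
    rw [sub_travelTime_smul_visibleDirection hΩo, travelTime_visibleDirection hΩo, kernelJ_eq y]
    push_cast
    ring
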